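/- Let $d\ge 2$ and $0<\epsilon<R<R'$. Let $\mathcal E(\mathbb R^d)$ be the space of smooth functions $\mathbb R^d\to\mathbb C$ with the topology of uniform convergence of derivatives of every order on compact sets, and let $\mathcal E'(\mathbb R^d)$ be its topological dual, the space of compactly supported distributions. Write $B(0,r)$ and $\overline B(0,r)$ for the open and the closed Euclidean ball of radius $r$. Let $\Gamma=\{(z,\theta)\in\mathbb R^d\times S^{d-1}: z\cdot\theta=0\}$ be the manifold of oriented lines, where $(z,\theta)$ stands for the line $\{z+s\theta: s\in\mathbb R\}$. For a smooth function $\eta\colon\Gamma\to\mathbb C$ put $$X^*\eta(x)=\int_{S^{d-1}}\eta\bigl(x-(x\cdot\theta)\theta,\theta\bigr)\,d\theta ,\qquad x\in\mathbb R^d,$$ which is a smooth function on $\mathbb R^d$. The X-ray transform $Xf$ of $f\in\mathcal E'(\mathbb R^d)$ is the distribution on $\Gamma$ given by $\langle Xf,\eta\rangle=\langle f,X^*\eta\rangle$ for all smooth $\eta$. For an open set $V\subset\mathbb R^d$, one says that $f$ integrates to zero over all lines that meet $V$ if the restriction of $Xf$ to the open set $\Gamma_V\subset\Gamma$ of lines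 meeting $V$ is zero, that is, $\langle Xf,\eta\rangle=0$ for every smooth $\eta$ on $\Gamma$ with compact support contained in $\Gamma_V$. Theorem. Let $f\in\mathcal E'(\mathbb R^d)$ satisfy $\operatorname{spt}(f)\subset\overline B(0,R')\setminus B(0,R)$. If $f$ integrates to zero over all lines that meet $B(0,\epsilon)$, then $f=0$. -/

import Mathlib

open Set Filter Topology MeasureTheory TopologicalSpace
open scoped ContDiff Distributions

noncomputable section

namespace XRay

/-- Euclidean space of dimension `d`. -/
abbrev Euc (d : ℕ) : Type := EuclideanSpace ℝ (Fin d)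

/-! ### Smooth functions and compactly supported distributions -/

/-- The complex vector space of smooth functions on Euclidean space, as a subspace of all
complex-valued functions. -/
def smoothSubmodule (d : ℕ) : Submodule ℂ (Euc d → ℂ) where
  carrier := {ψ | ContDiff ℝ ∞ ψ}
  add_mem' ha hb := by
    rw [mem_ofPred_eq] at *
    exact ha.add hb
  zero_mem' := by
    rw [mem_ofPred_eq]
    exact contDiff_const
  smul_mem' c _ h := by
    rw [mem_ofPred_eq] at *
    exact h.const_smul c

/-- The space `ℰ(ℝᵈ)` of smooth functions from `ℝᵈ` to `ℂ`. (A type of its own, so that it does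
not inherit the topology of pointwise convergence.) -/
def SmoothFunction (d : ℕ) : Type := smoothSubmodule d

namespace SmoothFunction

variable {d : ℕ}

instance : AddCommGroup (SmoothFunction d) := inferInstanceAs (AddCommGroup (smoothSubmodule d))

instance : Module ℂ (SmoothFunction d) := inferInstanceAs (Module ℂ (smoothSubmodule d))

instance : FunLike (SmoothFunction d) (Euc d) ℂ where
  coe ψ := ψ.1
  coe_injective := Subtype.val_injective

theorem contDiff (ψ : SmoothFunction d) : ContDiff ℝ ∞ (ψ : Euc d → ℂ) := ψ.2

/-- The derivative of order `k` of a smooth function, as a continuous function. -/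
def derivative (k : ℕ) (ψ : SmoothFunction d) :
    C(Euc d, ContinuousMultilinearMap ℝ (fun _ : Fin k => Euc d) ℂ) where
  toFun := iteratedFDeriv ℝ k ψ
  continuous_toFun := ψ.contDiff.continuous_iteratedFDeriv (by exact_mod_cast le_top)

/-- The topology of `ℰ(ℝᵈ)`: uniform convergence of the derivatives of every order on compact
sets. (The topology of `C(X, Y)` is the compact-open one.) -/
instance : TopologicalSpace (SmoothFunction d) :=
  ⨅ k : ℕ, TopologicalSpace.induced (derivative k) inferInstance

/-- A compactly supported smooth function is a smooth function. -/
def ofTestFunction (φ : 𝓓((⊤ : Opens (Euc d)), ℂ)) : SmoothFunction d := ⟨φ, φ.contDiff⟩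

end SmoothFunction

/-- The space `ℰ'(ℝᵈ)` of compactly supported distributions: the topological dual of
`ℰ(ℝᵈ)`. -/
abbrev CompactDistribution (d : ℕ) : Type := SmoothFunction d →L[ℂ] ℂ

/-- The support of `f ∈ ℰ'(ℝᵈ)`: the complement of the union of all open sets `U` such that
`⟨f, φ⟩ = 0` for all `φ ∈ 𝓓(ℝᵈ)` with support in `U`. -/
def CompactDistribution.support {d : ℕ} (f : CompactDistribution d) : Set (Euc d) :=
  Distribution.dsupport
    (fun φ : 𝓓((⊤ : Opens (Euc d)), ℂ) => f (SmoothFunction.ofTestFunction φ))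

/-! ### The manifold of oriented lines -/

/-- The set `Γ = {(z, θ) : |θ| = 1, z ⟂ θ}` of oriented lines in `ℝᵈ`; it carries the
topology of a closed submanifold of `ℝᵈ × (ℝᵈ ∖ {0})`. -/
abbrev OrientedLine (d : ℕ) : Type :=
  {p : Euc d × Euc d // ‖p.2‖ = 1 ∧ inner ℝ p.1 p.2 = 0}

/-- The points of the line `(z, θ)`. -/
def OrientedLine.carrier {d : ℕ} (γ : OrientedLine d) : Set (Euc d) :=
  range fun s : ℝ => γ.1.1 + s • γ.1.2

/-- The set `Γ_V` of the oriented lines that meet `V`. -/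
def linesMeeting {d : ℕ} (V : Set (Euc d)) : Set (OrientedLine d) :=
  {γ | (γ.carrier ∩ V).Nonempty}

/-- The space `ℰ(Γ)` of smooth functions on the submanifold `Γ`: the restrictions to `Γ` of
functions that are smooth on an open neighbourhood of `Γ` in `ℝᵈ × ℝᵈ`. -/
def LineFunction (d : ℕ) : Submodule ℂ (OrientedLine d → ℂ) where
  carrier := {η | ∃ (U : Set (Euc d × Euc d)) (H : Euc d × Euc d → ℂ), IsOpen U ∧
    (∀ γ : OrientedLine d, γ.1 ∈ U) ∧ ContDiffOn ℝ ∞ H U ∧ ∀ γ : OrientedLine d, η γ = H γ.1}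
  add_mem' := by
    rintro a b ⟨U, H, hU, hΓ, hH, ha⟩ ⟨U', H', hU', hΓ', hH', hb⟩
    exact ⟨U ∩ U', H + H', hU.inter hU', fun γ => ⟨hΓ γ, hΓ' γ⟩,
      (hH.mono inter_subset_left).add (hH'.mono inter_subset_right),
      fun γ => by simp [ha, hb]⟩
  zero_mem' := ⟨univ, 0, isOpen_univ, fun _ => mem_univ _, contDiffOn_const, fun _ => rfl⟩
  smul_mem' := by
    rintro c a ⟨U, H, hU, hΓ, hH, ha⟩
    exact ⟨U, c • H, hU, hΓ, hH.const_smul c, fun γ => by simp [ha]⟩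

/-! ### The formal adjoint of the X-ray transform -/

/-- The oriented line through `x` in the direction `θ`. -/
def lineThrough {d : ℕ} (x : Euc d) (θ : Metric.sphere (0 : Euc d) 1) : OrientedLine d :=
  ⟨(x - inner ℝ x (θ : Euc d) • (θ : Euc d), θ), by
    have h : ‖(θ : Euc d)‖ = 1 := by simp
    refine ⟨h, ?_⟩
    simp [inner_sub_left, real_inner_smul_left, h]⟩

/-- The surface measure of the unit sphere. -/
def sphereMeasure (d : ℕ) : Measure (Metric.sphere (0 : Euc d) 1) :=
  (volume : Measure (Euc d)).toSphere

instance (d : ℕ) : IsFiniteMeasure (sphereMeasure d) := by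
  unfold sphereMeasure; infer_instance

/-- Integration over the sphere of a function that depends smoothly on a parameter. -/
theorem contDiff_sphere_integral_aux {d : ℕ} (n : ℕ) :
    ∀ {F : Type} [NormedAddCommGroup F] [NormedSpace ℝ F]
      {W : Set (Euc d × Euc d)} {G : Euc d × Euc d → F}, IsOpen W →
      (∀ (x : Euc d) (θ : Metric.sphere (0 : Euc d) 1), (x, (θ : Euc d)) ∈ W) →
      ContDiffOn ℝ ∞ G W →
      ContDiff ℝ n (fun x => ∫ θ : Metric.sphere (0 : Euc d) 1, G (x, θ) ∂(sphereMeasure d)) := by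
  have hcont : ∀ {F : Type} [NormedAddCommGroup F] [NormedSpace ℝ F]
      {W : Set (Euc d × Euc d)} {G : Euc d × Euc d → F},
      (∀ (x : Euc d) (θ : Metric.sphere (0 : Euc d) 1), (x, (θ : Euc d)) ∈ W) →
      ContinuousOn G W →
      Continuous (fun p : Euc d × Metric.sphere (0 : Euc d) 1 => G (p.1, (p.2 : Euc d))) := by
    intro F _ _ W G hW hG
    exact hG.comp_continuous (by fun_prop) fun p => hW p.1 p.2
  induction n with
  | zero =>
    intro F _ _ W G _ hW hG
    simp only [Nat.cast_zero, contDiff_zero]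
    have h := hcont hW hG.continuousOn
    have := continuous_parametric_integral_of_continuous (μ := sphereMeasure d)
      (f := fun x (θ : Metric.sphere (0 : Euc d) 1) => G (x, (θ : Euc d))) (s := univ)
      h isCompact_univ
    simpa using this
  | succ n ih =>
    intro F _ _ W G hWo hW hG
    set G' : Euc d × Euc d → (Euc d →L[ℝ] F) :=
      fun p => (fderiv ℝ G p).comp (ContinuousLinearMap.inl ℝ (Euc d) (Euc d)) with hG'
    have hG's : ContDiffOn ℝ ∞ G' W :=
      (hG.fderiv_of_isOpen hWo (by simp)).clm_comp contDiffOn_const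
    have hc := hcont hW hG.continuousOn
    have hc' := hcont hW hG's.continuousOn
    have hder : ∀ x : Euc d, HasFDerivAt
        (fun x => ∫ θ : Metric.sphere (0 : Euc d) 1, G (x, θ) ∂(sphereMeasure d))
        (∫ θ : Metric.sphere (0 : Euc d) 1, G' (x, θ) ∂(sphereMeasure d)) x := by
      intro x
      obtain ⟨C, hC⟩ := (((isCompact_closedBall x 1).prod
        (isCompact_univ : IsCompact (univ : Set (Metric.sphere (0 : Euc d) 1))))).exists_bound_of_continuousOn
          hc'.continuousOn
      have hi : ∀ y, Continuous (fun θ : Metric.sphere (0 : Euc d) 1 => G (y, (θ : Euc d))) :=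
        fun y => hc.comp (Continuous.prodMk_right y)
      have hi' : ∀ y, Continuous (fun θ : Metric.sphere (0 : Euc d) 1 => G' (y, (θ : Euc d))) :=
        fun y => hc'.comp (Continuous.prodMk_right y)
      refine hasFDerivAt_integral_of_dominated_of_fderiv_le (bound := fun _ => C)
        (F := fun y (θ : Metric.sphere (0 : Euc d) 1) => G (y, (θ : Euc d)))
        (F' := fun y (θ : Metric.sphere (0 : Euc d) 1) => G' (y, (θ : Euc d)))
        (Metric.closedBall_mem_nhds x one_pos)
        (Eventually.of_forall fun y => (hi y).aestronglyMeasurable_of_compactSpace) ?_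
        (hi' x).aestronglyMeasurable_of_compactSpace
        (Eventually.of_forall fun θ y hy => hC (y, θ) ⟨hy, mem_univ _⟩)
        (integrable_const _) (Eventually.of_forall fun θ y _ => ?_)
      · exact (hi x).integrable_of_hasCompactSupport (HasCompactSupport.of_compactSpace _)
      · have h1 : HasFDerivAt G (fderiv ℝ G (y, (θ : Euc d))) (y, (θ : Euc d)) :=
          ((hG.contDiffAt (hWo.mem_nhds (hW y θ))).differentiableAt (by simp)).hasFDerivAt
        exact h1.comp y (hasFDerivAt_prodMk_left y (θ : Euc d))
    rw [Nat.cast_add, Nat.cast_one, contDiff_succ_iff_fderiv]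
    refine ⟨fun x => (hder x).differentiableAt, by simp, ?_⟩
    have : fderiv ℝ (fun x => ∫ θ : Metric.sphere (0 : Euc d) 1, G (x, θ) ∂(sphereMeasure d)) =
        fun x => ∫ θ : Metric.sphere (0 : Euc d) 1, G' (x, θ) ∂(sphereMeasure d) :=
      funext fun x => (hder x).fderiv
    rw [this]
    exact ih hWo hW hG's

/-- A smooth function on `Γ`, read off on `ℝᵈ × S^{d-1}`, extends smoothly to an open set. -/
theorem lineFunction_extension {d : ℕ} (η : LineFunction d) :
    ∃ (W : Set (Euc d × Euc d)) (G : Euc d × Euc d → ℂ), IsOpen W ∧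
      (∀ (x : Euc d) (θ : Metric.sphere (0 : Euc d) 1), (x, (θ : Euc d)) ∈ W) ∧
      ContDiffOn ℝ ∞ G W ∧
      ∀ (x : Euc d) (θ : Metric.sphere (0 : Euc d) 1), η.1 (lineThrough x θ) = G (x, θ) := by
  obtain ⟨U, H, hU, hΓ, hH, hη⟩ := η.2
  have hm : ContDiff ℝ ∞ (fun p : Euc d × Euc d => (p.1 - inner ℝ p.1 p.2 • p.2, p.2)) :=
    (contDiff_fst.sub ((contDiff_fst.inner ℝ contDiff_snd).smul contDiff_snd)).prodMk contDiff_snd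
  exact ⟨_, H ∘ _, hU.preimage hm.continuous, fun x θ => hΓ (lineThrough x θ),
    hH.comp hm.contDiffOn fun _ h => h, fun x θ => hη _⟩

theorem continuous_lineFunction {d : ℕ} (η : LineFunction d) (x : Euc d) :
    Continuous fun θ : Metric.sphere (0 : Euc d) 1 => η.1 (lineThrough x θ) := by
  obtain ⟨W, G, _, hW, hG, h⟩ := lineFunction_extension η
  simp only [h]
  exact hG.continuousOn.comp_continuous (by fun_prop) fun θ => hW x θ

theorem integrable_lineFunction {d : ℕ} (η : LineFunction d) (x : Euc d) :
    Integrable (fun θ : Metric.sphere (0 : Euc d) 1 => η.1 (lineThrough x θ))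
      (sphereMeasure d) :=
  (continuous_lineFunction η x).integrable_of_hasCompactSupport
    (HasCompactSupport.of_compactSpace _)

/-- The formal adjoint `X* : ℰ(Γ) → ℰ(ℝᵈ)` of the X-ray transform,
`X*η (x) = ∫_{S^{d-1}} η(x - (x·θ)θ, θ) dθ`. -/
def adjoint (d : ℕ) : LineFunction d →ₗ[ℂ] SmoothFunction d where
  toFun η := ⟨fun x => ∫ θ : Metric.sphere (0 : Euc d) 1, η.1 (lineThrough x θ) ∂(sphereMeasure d),
    by
      obtain ⟨W, G, hWo, hW, hG, h⟩ := lineFunction_extension η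
      simp only [h]
      exact contDiff_infty.2 fun n => contDiff_sphere_integral_aux n hWo hW hG⟩
  map_add' η η' := by
    refine Subtype.ext (funext fun x => ?_)
    exact integral_add (integrable_lineFunction η x) (integrable_lineFunction η' x)
  map_smul' c η := by
    refine Subtype.ext (funext fun x => ?_)
    exact integral_const_mul c _

/-! ### The X-ray transform of a compactly supported distribution -/

/-- The X-ray transform `Xf` of `f ∈ ℰ'(ℝᵈ)`, defined by duality: `⟨Xf, η⟩ = ⟨f, X*η⟩` for all
`η ∈ ℰ(Γ)`. -/
def xray {d : ℕ} (f : CompactDistribution d) : LineFunction d →ₗ[ℂ] ℂ :=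
  f.toLinearMap ∘ₗ adjoint d

/-- `f` integrates to zero over all lines that meet the open set `V`: the restriction of the
distribution `Xf` to the open set `Γ_V` is zero, that is, `⟨Xf, η⟩ = 0` for every smooth function
`η` on `Γ` with compact support in `Γ_V`. -/
def VanishesOnLinesMeeting {d : ℕ} (f : CompactDistribution d) (V : Set (Euc d)) : Prop :=
  ∀ η : LineFunction d, HasCompactSupport η.1 → tsupport η.1 ⊆ linesMeeting V → xray f η = 0

end XRay

end

/-!
Write `N = ‖y‖ ^ 2`. The proof tests `f` against kernels `N ^ s * q` with `q` a polynomial.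

* The hypothesis, applied to averages over lines `(z, θ) ↦ q θ * ∫ φ (z + t θ) dt` of test functions
  `φ` supported in `B(0, ε)`, says in polar coordinates that `f` is orthogonal to the convolution of
  `φ` with `‖y‖ ^ (1 - d) * q (y / ‖y‖)`, for `q` homogeneous of even degree. As `φ` is arbitrary,
  `f` annihilates all translates of these kernels by vectors of norm less than `ε`
  (`kernelFn_mem_annihilated`).
* The class of functions whose small translates are annihilated by `f` is closed under
  differentiation (`dirDeriv_mem_annihilated`). Starting with all even kernels of degree `1 - d`,
  derivatives of order `k` produce all kernels of degree `1 - d - k` with the parity of `k`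
  (`mem_of_parity`). For `k ≥ 2` a kernel `G` of degree `1 - d - k` is a multiple of the divergence
  of `y G`. For `k = 1` this divergence is zero, and one uses instead that the spherical Laplacian
  is invertible on odd functions (`mem_of_odd`).
* In particular `f` annihilates `‖y‖ ^ (1 - d) * q (y / ‖y‖ ^ 2)` for every polynomial `q`. The
  inversion `y ↦ y / ‖y‖ ^ 2` is a diffeomorphism near the support of `f`, and polynomials are dense
  in the smooth functions (`apply_invPullback_eq_zero`). Hence `f = 0`.

All kernels are singular at the origin only, which is far from the support of `f`; they are modified
near the origin so as to be smooth (`regSq`). The modification is harmless because `f` depends only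
on values near its support (`vanishesOn_compl_support`). That `f` commutes with integrals over a
parameter (`apply_setIntegral`) follows from its being a continuous functional of finitely many
derivatives on a compact set (`exists_eq_comp_jet`).
-/

noncomputable section

namespace XRay

/-! ### Differentiation under the integral sign -/

section ParametricIntegral

variable {E A F : Type*} [NormedAddCommGroup E] [NormedSpace ℝ E]
  [NormedAddCommGroup A] [NormedSpace ℝ A] [NormedAddCommGroup F] [NormedSpace ℝ F]

theorem contDiff_slice {G : E × A → F} (hG : ContDiff ℝ ∞ G) (a : A) :
    ContDiff ℝ ∞ (fun x => G (x, a)) :=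
  hG.comp (contDiff_id.prodMk contDiff_const)

theorem iteratedFDeriv_slice {G : E × A → F} (hG : ContDiff ℝ ∞ G) (k : ℕ) (x : E) (a : A) :
    iteratedFDeriv ℝ k (fun x => G (x, a)) x =
      (iteratedFDeriv ℝ k G (x, a)).compContinuousLinearMap
        (fun _ => ContinuousLinearMap.inl ℝ E A) := by
  have h1 : (fun x => G (x, a)) =
      (fun p => G (p + ((0 : E), a))) ∘ (ContinuousLinearMap.inl ℝ E A) := by
    funext x; simp
  have h2 : ContDiff ℝ ∞ (fun p => G (p + ((0 : E), a))) :=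
    hG.comp (contDiff_id.add contDiff_const)
  rw [h1, ContinuousLinearMap.iteratedFDeriv_comp_right _ h2 x (by exact_mod_cast le_top),
    iteratedFDeriv_comp_add_right]
  simp

theorem continuous_iteratedFDeriv_slice {G : E × A → F} (hG : ContDiff ℝ ∞ G) (k : ℕ) :
    Continuous (fun p : E × A => iteratedFDeriv ℝ k (fun x => G (x, p.2)) p.1) := by
  simp only [iteratedFDeriv_slice hG]
  exact (ContinuousMultilinearMap.compContinuousLinearMapL (F := F)
    (fun _ : Fin k => ContinuousLinearMap.inl ℝ E A)).continuous.comp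
      (hG.continuous_iteratedFDeriv (by exact_mod_cast le_top))

variable [MeasurableSpace A] [BorelSpace A] [FiniteDimensional ℝ E] [FiniteDimensional ℝ A]
  {μ : Measure A} [IsFiniteMeasureOnCompacts μ] {s : Set A}

theorem hasFDerivAt_setIntegral {H : E → A → F} {H' : E → A → E →L[ℝ] F}
    (hs : IsCompact s)
    (hH : Continuous fun p : E × A => H p.1 p.2) (hH' : Continuous fun p : E × A => H' p.1 p.2)
    (hd : ∀ x a, HasFDerivAt (fun x => H x a) (H' x a) x) (x : E) :
    HasFDerivAt (fun x => ∫ a in s, H x a ∂μ) (∫ a in s, H' x a ∂μ) x := by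
  have : ProperSpace E := FiniteDimensional.proper ℝ E
  have : ProperSpace A := FiniteDimensional.proper ℝ A
  have : SecondCountableTopology A := secondCountable_of_proper
  obtain ⟨C, hC⟩ := ((isCompact_closedBall x 1).prod hs).exists_bound_of_continuousOn
    hH'.continuousOn
  have hi : ∀ y, Continuous (H y) := fun y => hH.comp (Continuous.prodMk_right y)
  have hi' : ∀ y, Continuous (H' y) := fun y => hH'.comp (Continuous.prodMk_right y)
  refine hasFDerivAt_integral_of_dominated_of_fderiv_le (bound := fun _ => C)
    (Metric.closedBall_mem_nhds x one_pos)
    (Eventually.of_forall fun y => (hi y).aestronglyMeasurable)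
    ((hi x).continuousOn.integrableOn_compact hs)
    (hi' x).aestronglyMeasurable ?_ ?_ (Eventually.of_forall fun a y _ => hd y a)
  · filter_upwards [ae_restrict_mem hs.measurableSet] with a ha y hy
    exact hC (y, a) ⟨hy, ha⟩
  · exact continuousOn_const.integrableOn_compact hs

variable (E F) in
/-- Currying of the first variable of a multilinear map, as a continuous linear map. -/
def curryLeftCLM (k : ℕ) :
    ContinuousMultilinearMap ℝ (fun _ : Fin (k + 1) => E) F →L[ℝ]
      (E →L[ℝ] ContinuousMultilinearMap ℝ (fun _ : Fin k => E) F) :=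
  (continuousMultilinearCurryLeftEquiv ℝ (fun _ : Fin (k + 1) => E) F
    ).toContinuousLinearEquiv.toContinuousLinearMap

theorem iteratedFDeriv_setIntegral_aux [CompleteSpace F] {G : E × A → F} (hG : ContDiff ℝ ∞ G)
    (hs : IsCompact s) (k : ℕ) :
    iteratedFDeriv ℝ k (fun x => ∫ a in s, G (x, a) ∂μ) =
      (fun x => ∫ a in s, iteratedFDeriv ℝ k (fun x => G (x, a)) x ∂μ) ∧
    Differentiable ℝ
      (fun x => ∫ a in s, iteratedFDeriv ℝ k (fun x => G (x, a)) x ∂μ) := by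
  have hder : ∀ (k : ℕ) (x : E), HasFDerivAt
      (fun x => ∫ a in s, iteratedFDeriv ℝ k (fun x => G (x, a)) x ∂μ)
      (∫ a in s, curryLeftCLM E F k
        (iteratedFDeriv ℝ (k + 1) (fun x => G (x, a)) x) ∂μ) x := by
    intro k x
    refine hasFDerivAt_setIntegral
      (H' := fun x a => curryLeftCLM E F k (iteratedFDeriv ℝ (k + 1) (fun x => G (x, a)) x))
      hs (continuous_iteratedFDeriv_slice hG k)
      ((curryLeftCLM E F k).continuous.comp (continuous_iteratedFDeriv_slice hG (k + 1)))
      (fun y a => ?_) x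
    have h := ((contDiff_slice hG a).differentiable_iteratedFDeriv
      (m := k) (by exact_mod_cast ENat.natCast_lt_top k)) y
    have h' := h.hasFDerivAt
    rw [fderiv_iteratedFDeriv] at h'
    exact h'
  refine ⟨?_, fun x => (hder k x).differentiableAt⟩
  induction k with
  | zero =>
    funext x
    ext m
    simp only [iteratedFDeriv_zero_eq_comp, Function.comp]
    have := ((continuousMultilinearCurryFin0 ℝ E F).symm.toContinuousLinearEquiv
      ).toContinuousLinearMap.integral_comp_comm (μ := μ.restrict s) (φ := fun a => G (x, a))
      ((hG.continuous.comp (Continuous.prodMk_right x)).continuousOn.integrableOn_compact hs)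
    exact congrArg (fun f => f m) this.symm
  | succ k ih =>
    rw [iteratedFDeriv_succ_eq_comp_left, ih]
    funext x
    rw [Function.comp_apply, (hder k x).fderiv]
    have hint : IntegrableOn (fun a => iteratedFDeriv ℝ (k + 1) (fun x => G (x, a)) x) s μ :=
      ((continuous_iteratedFDeriv_slice hG (k + 1)).comp
        (Continuous.prodMk_right x)).continuousOn.integrableOn_compact hs
    rw [ContinuousLinearMap.integral_comp_comm (𝕜 := ℝ)
      (Fₗ := E →L[ℝ] ContinuousMultilinearMap ℝ (fun _ : Fin k => E) F)
      (curryLeftCLM E F k) hint]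
    exact LinearIsometryEquiv.symm_apply_apply _ _

/-- Derivatives of every order pass under an integral over a compact set of parameters. -/
theorem iteratedFDeriv_setIntegral [CompleteSpace F] {G : E × A → F} (hG : ContDiff ℝ ∞ G)
    (hs : IsCompact s) (k : ℕ) (x : E) :
    iteratedFDeriv ℝ k (fun x => ∫ a in s, G (x, a) ∂μ) x =
      ∫ a in s, iteratedFDeriv ℝ k (fun x => G (x, a)) x ∂μ :=
  congrFun (iteratedFDeriv_setIntegral_aux hG hs k).1 x

theorem contDiff_setIntegral [CompleteSpace F] {G : E × A → F} (hG : ContDiff ℝ ∞ G)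
    (hs : IsCompact s) : ContDiff ℝ ∞ (fun x => ∫ a in s, G (x, a) ∂μ) := by
  refine contDiff_of_differentiable_iteratedFDeriv (n := ⊤) fun k _ => ?_
  rw [(iteratedFDeriv_setIntegral_aux hG hs k).1]
  exact (iteratedFDeriv_setIntegral_aux hG hs k).2

end ParametricIntegral

/-! ### Compactly supported distributions and jets -/

section Jets

variable {d : ℕ}

/-- Multilinear forms of degree `k`, the values of the derivative of order `k`. (A type of its own,
so that its only topology is the one of the operator norm.) -/
def Form (d k : ℕ) : Type := ContinuousMultilinearMap ℝ (fun _ : Fin k => Euc d) ℂ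

instance (k : ℕ) : NormedAddCommGroup (Form d k) :=
  inferInstanceAs (NormedAddCommGroup (ContinuousMultilinearMap ℝ (fun _ : Fin k => Euc d) ℂ))

instance (k : ℕ) : NormedSpace ℂ (Form d k) :=
  inferInstanceAs (NormedSpace ℂ (ContinuousMultilinearMap ℝ (fun _ : Fin k => Euc d) ℂ))

instance (k : ℕ) : CompleteSpace (Form d k) :=
  inferInstanceAs (CompleteSpace (ContinuousMultilinearMap ℝ (fun _ : Fin k => Euc d) ℂ))

/-- The Banach space of families of continuous functions on the compact set `K`, one with values
in the forms of degree `k` for each `k < n`. -/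
abbrev JetSpace (d n : ℕ) (K : Compacts (Euc d)) : Type := ∀ k : Fin n, C(K, Form d k)

namespace SmoothFunction

@[simp] theorem add_apply (ψ χ : SmoothFunction d) (x : Euc d) : (ψ + χ) x = ψ x + χ x := rfl

@[simp] theorem sub_apply (ψ χ : SmoothFunction d) (x : Euc d) : (ψ - χ) x = ψ x - χ x := rfl

@[simp] theorem smul_apply (c : ℂ) (ψ : SmoothFunction d) (x : Euc d) : (c • ψ) x = c * ψ x := rfl

@[simp] theorem zero_apply (x : Euc d) : (0 : SmoothFunction d) x = 0 := rfl

@[ext] theorem ext {ψ χ : SmoothFunction d} (h : ∀ x, ψ x = χ x) : ψ = χ := DFunLike.ext _ _ h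

/-- A smooth function as an element of `ℰ(ℝᵈ)`. -/
def mk (ψ : Euc d → ℂ) (h : ContDiff ℝ ∞ ψ) : SmoothFunction d := ⟨ψ, h⟩

@[simp] theorem mk_apply (ψ : Euc d → ℂ) (h : ContDiff ℝ ∞ ψ) (x : Euc d) : mk ψ h x = ψ x := rfl

theorem derivative_apply (k : ℕ) (ψ : SmoothFunction d) (x : Euc d) :
    derivative k ψ x = iteratedFDeriv ℝ k ψ x := rfl

theorem derivative_add (k : ℕ) (ψ χ : SmoothFunction d) :
    derivative k (ψ + χ) = derivative k ψ + derivative k χ := by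
  ext1 x
  exact iteratedFDeriv_add_apply (ψ.contDiff.contDiffAt.of_le (by exact_mod_cast le_top))
    (χ.contDiff.contDiffAt.of_le (by exact_mod_cast le_top))

theorem derivative_smul (k : ℕ) (c : ℂ) (ψ : SmoothFunction d) :
    derivative k (c • ψ) = c • derivative k ψ := by
  ext1 x
  exact iteratedFDeriv_const_smul_apply (ψ.contDiff.contDiffAt.of_le (by exact_mod_cast le_top))

/-- The derivatives of orders `k < n` on the compact set `K`. -/
def jet (n : ℕ) (K : Compacts (Euc d)) : SmoothFunction d →ₗ[ℂ] JetSpace d n K where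
  toFun ψ k := ⟨fun x => derivative k ψ x,
    (derivative k ψ).continuous.comp continuous_subtype_val⟩
  map_add' ψ χ := by
    funext k
    ext1 x
    exact congrArg (fun h => h (x : Euc d)) (derivative_add k ψ χ)
  map_smul' c ψ := by
    funext k
    ext1 x
    exact congrArg (fun h => h (x : Euc d)) (derivative_smul k c ψ)

theorem jet_apply (n : ℕ) (K : Compacts (Euc d)) (ψ : SmoothFunction d) (k : Fin n) (x : K) :
    jet n K ψ k x = iteratedFDeriv ℝ k ψ x := rfl

end SmoothFunction

open SmoothFunction

namespace CompactDistribution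

/-- A distribution of compact support is small on functions with small jets. -/
theorem exists_jet_bound (f : CompactDistribution d) :
    ∃ (n : ℕ) (K : Compacts (Euc d)) (r : ℝ), 0 < r ∧
      ∀ ψ : SmoothFunction d, ‖jet n K ψ‖ < r → ‖f ψ‖ < 1 := by
  let K : ℕ → Compacts (Euc d) := fun n => ⟨Metric.closedBall 0 n, isCompact_closedBall _ _⟩
  by_contra! hcon
  choose ψ hψ hfψ using fun n : ℕ => hcon n (K n) (1 / ((n : ℝ) + 1)) (by positivity)
  have hlim : Tendsto ψ atTop (𝓝 0) := by
    rw [nhds_iInf, tendsto_iInf]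
    intro k
    rw [nhds_induced, tendsto_comap_iff,
      ContinuousMap.tendsto_iff_forall_isCompact_tendstoUniformlyOn]
    intro C hC
    have h0 : derivative k (0 : SmoothFunction d) = 0 := by
      ext1 x
      change iteratedFDeriv ℝ k (fun _ => (0 : ℂ)) x = 0
      simp
    obtain ⟨m, hm⟩ := hC.isBounded.subset_closedBall (0 : Euc d)
    rw [Metric.tendstoUniformlyOn_iff]
    intro e he
    obtain ⟨N, hN⟩ := exists_nat_one_div_lt he
    obtain ⟨M, hM⟩ := exists_nat_ge m
    filter_upwards [eventually_ge_atTop (max N (max M (k + 1)))] with n hn x hx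
    simp only [max_le_iff] at hn
    have hxK : x ∈ K n := by
      have h1 : (M : ℝ) ≤ n := by exact_mod_cast hn.2.1
      exact Metric.closedBall_subset_closedBall (hM.trans h1) (hm hx)
    have h1 : ‖jet n (K n) (ψ n) ⟨k, hn.2.2⟩ ⟨x, hxK⟩‖ ≤ ‖jet n (K n) (ψ n)‖ :=
      (ContinuousMap.norm_coe_le_norm _ _).trans (norm_le_pi_norm _ _)
    rw [h0]
    simp only [Function.comp_apply, ContinuousMap.zero_apply, dist_zero_left, derivative_apply]
    rw [jet_apply] at h1
    have h2 : (1 : ℝ) / (n + 1) ≤ 1 / (N + 1) := by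
      have : (N : ℝ) ≤ n := by exact_mod_cast hn.1
      gcongr
    exact ((h1.trans_lt (hψ n)).trans_le h2).trans hN
  have h := (f.continuous.tendsto 0).comp hlim
  rw [map_zero] at h
  obtain ⟨n, hn⟩ := (h.norm.eventually_lt_const (u := 1) (by simp)).exists
  exact absurd hn (not_lt.2 (hfψ n))

/-- A distribution of compact support is of finite order: it is a continuous linear functional of
finitely many derivatives on a compact set. By the Hahn–Banach theorem the functional extends to
the whole Banach space of jets, which is where integrals of families of functions are taken. -/
theorem exists_eq_comp_jet (f : CompactDistribution d) :
    ∃ (n : ℕ) (K : Compacts (Euc d)) (g : JetSpace d n K →L[ℂ] ℂ), ∀ ψ, f ψ = g (jet n K ψ) := by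
  obtain ⟨n, K, r, hr, hb⟩ := exists_jet_bound f
  refine ⟨n, K, ?_⟩
  have hker : ∀ ψ, jet n K ψ = 0 → f ψ = 0 := by
    intro ψ hψ
    by_contra hne
    have h := hb ((f ψ)⁻¹ • ψ) (by
      rw [map_smul, hψ, smul_zero (A := JetSpace d n K), norm_zero]; exact hr)
    rw [map_smul, smul_eq_mul, inv_mul_cancel₀ hne] at h
    simp at h
  obtain ⟨s, hs⟩ := (jet n K).rangeRestrict.exists_rightInverse_of_surjective
    (LinearMap.range_rangeRestrict _)
  have hs' : ∀ y : LinearMap.range (jet n K), jet n K (s y) = y := fun y =>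
    congrArg Subtype.val (LinearMap.congr_fun hs y)
  let g₀ : LinearMap.range (jet n K) →ₗ[ℂ] ℂ := f.toLinearMap ∘ₗ s
  have hg₀ : ∀ y, ‖g₀ y‖ ≤ 1 / (r / 2) * ‖y‖ := by
    refine LinearMap.bound_of_ball_bound' (half_pos hr) 1 g₀ fun y hy => ?_
    refine (hb (s y) ?_).le
    rw [hs' y]
    have : ‖(y : JetSpace d n K)‖ ≤ r / 2 := by simpa using hy
    linarith
  obtain ⟨g, hg, -⟩ := exists_extension_norm_eq (𝕜 := ℂ) (LinearMap.range (jet n K))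
    (g₀.mkContinuous _ hg₀)
  refine ⟨g, fun ψ => ?_⟩
  have h1 := hg ⟨jet n K ψ, LinearMap.mem_range_self _ _⟩
  rw [h1]
  have h2 := hker (ψ - s ⟨jet n K ψ, LinearMap.mem_range_self _ _⟩) (by
    rw [map_sub, hs', sub_self])
  rw [map_sub, sub_eq_zero] at h2
  exact h2

end CompactDistribution

/-! ### Families of smooth functions depending on a parameter -/

variable {A : Type*} [NormedAddCommGroup A] [NormedSpace ℝ A]

/-- The function `x ↦ G (x, a)` as an element of `ℰ(ℝᵈ)`. -/
def sliceFunction (G : Euc d × A → ℂ) (hG : ContDiff ℝ ∞ G) (a : A) : SmoothFunction d :=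
  SmoothFunction.mk (fun x => G (x, a)) (contDiff_slice hG a)

theorem continuous_jet_slice {G : Euc d × A → ℂ} (hG : ContDiff ℝ ∞ G) (n : ℕ)
    (K : Compacts (Euc d)) : Continuous fun a => jet n K (sliceFunction G hG a) := by
  refine continuous_pi fun k => ContinuousMap.continuous_of_continuous_uncurry _ ?_
  exact (continuous_iteratedFDeriv_slice hG k).comp
    ((continuous_subtype_val.comp continuous_snd).prodMk continuous_fst)

namespace CompactDistribution

theorem continuous_apply_slice (f : CompactDistribution d) {G : Euc d × A → ℂ}
    (hG : ContDiff ℝ ∞ G) : Continuous fun a => f (sliceFunction G hG a) := by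
  obtain ⟨n, K, g, hg⟩ := f.exists_eq_comp_jet
  simp only [hg]
  exact g.continuous.comp (continuous_jet_slice hG n K)

variable [MeasurableSpace A] [BorelSpace A] [FiniteDimensional ℝ A]
  {μ : Measure A} [IsFiniteMeasureOnCompacts μ] {s : Set A}

/-- A distribution of compact support may be applied under an integral over a compact set of
parameters. -/
theorem apply_setIntegral (f : CompactDistribution d) {G : Euc d × A → ℂ}
    (hG : ContDiff ℝ ∞ G) (hs : IsCompact s) :
    f (SmoothFunction.mk (fun x => ∫ a in s, G (x, a) ∂μ) (contDiff_setIntegral hG hs)) =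
      ∫ a in s, f (sliceFunction G hG a) ∂μ := by
  obtain ⟨n, K, g, hg⟩ := f.exists_eq_comp_jet
  simp only [hg]
  have hint : IntegrableOn (fun a => jet n K (sliceFunction G hG a)) s μ :=
    (continuous_jet_slice hG n K).continuousOn.integrableOn_compact hs
  rw [g.integral_comp_comm hint]
  congr 1
  funext k
  ext1 x
  let ev : JetSpace d n K →L[ℂ] Form d k :=
    (ContinuousMap.evalCLM ℂ x).comp (ContinuousLinearMap.proj k)
  have h : ev (∫ a in s, jet n K (sliceFunction G hG a) ∂μ) =
      ∫ a in s, ev (jet n K (sliceFunction G hG a)) ∂μ := (ev.integral_comp_comm hint).symm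
  change _ = ev (∫ a in s, jet n K (sliceFunction G hG a) ∂μ)
  rw [h, jet_apply]
  exact iteratedFDeriv_setIntegral hG hs k x

end CompactDistribution

end Jets

/-! ### Locality -/

section Locality

variable {d : ℕ}

/-- A smooth cutoff function: `0` near `s` and `1` near `t`. -/
theorem exists_contDiff_zero_one {s t : Set (Euc d)} (hs : IsClosed s) (ht : IsClosed t)
    (hd : Disjoint s t) : ∃ χ : Euc d → ℂ, ContDiff ℝ ∞ χ ∧ s ⊆ (tsupport χ)ᶜ ∧
      t ⊆ (tsupport fun x => 1 - χ x)ᶜ := by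
  obtain ⟨χ, h0, h1, -⟩ := exists_contMDiffMap_zero_one_nhds_of_isClosed (n := ⊤)
    (modelWithCornersSelf ℝ (Euc d)) hs ht hd
  refine ⟨fun x => (χ x : ℂ), Complex.ofRealCLM.contDiff.comp χ.contMDiff.contDiff, ?_, ?_⟩
  · intro x hx
    rw [mem_compl_iff, notMem_tsupport_iff_eventuallyEq]
    filter_upwards [Filter.Eventually.filter_mono (nhds_le_nhdsSet hx) h0] with y hy
    simp [hy]
  · intro x hx
    rw [mem_compl_iff, notMem_tsupport_iff_eventuallyEq]
    filter_upwards [Filter.Eventually.filter_mono (nhds_le_nhdsSet hx) h1] with y hy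
    simp [hy]

namespace CompactDistribution

/-- `f` vanishes on all smooth functions, of compact support or not, with support in `U`. -/
def VanishesOn (f : CompactDistribution d) (U : Set (Euc d)) : Prop :=
  ∀ ψ : SmoothFunction d, tsupport ψ ⊆ U → f ψ = 0

theorem exists_vanishesOn_compl_compact (f : CompactDistribution d) :
    ∃ K : Set (Euc d), IsCompact K ∧ f.VanishesOn Kᶜ := by
  obtain ⟨n, K, g, hg⟩ := f.exists_eq_comp_jet
  refine ⟨K, K.isCompact, fun ψ hψ => ?_⟩
  rw [hg]
  have : SmoothFunction.jet n K ψ = 0 := by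
    funext k
    ext1 x
    rw [SmoothFunction.jet_apply]
    have h1 : (x : Euc d) ∉ tsupport (iteratedFDeriv ℝ k ψ) := fun h =>
      hψ (tsupport_iteratedFDeriv_subset (𝕜 := ℝ) (k : ℕ) h) x.2
    exact image_eq_zero_of_notMem_tsupport h1
  rw [this, map_zero]

theorem VanishesOn.union {f : CompactDistribution d} {U V : Set (Euc d)} (hU : f.VanishesOn U)
    (hUo : IsOpen U) (hVo : IsOpen V) (hV : f.VanishesOn V) : f.VanishesOn (U ∪ V) := by
  intro ψ hψ
  obtain ⟨χ, hχ, h0, h1⟩ := exists_contDiff_zero_one (s := Uᶜ) (t := tsupport ψ \ V)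
    hUo.isClosed_compl ((isClosed_tsupport ψ).sdiff hVo)
    (Set.disjoint_left.2 fun x hx hx' => (hψ hx'.1).elim hx hx'.2)
  have e : ψ = SmoothFunction.mk (fun x => χ x * ψ x) (hχ.mul ψ.contDiff) +
      SmoothFunction.mk (fun x => (1 - χ x) * ψ x)
        ((contDiff_const.sub hχ).mul ψ.contDiff) := by
    ext x
    simp only [SmoothFunction.add_apply, SmoothFunction.mk_apply]
    ring
  rw [e, map_add, hU, hV, add_zero]
  · intro x hx
    by_contra hxV
    have hx1 : x ∈ tsupport ψ := tsupport_mul_subset_right (f := fun x => 1 - χ x) hx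
    exact h1 ⟨hx1, hxV⟩ (tsupport_mul_subset_left (g := ψ) hx)
  · intro x hx
    by_contra hxU
    exact h0 hxU (tsupport_mul_subset_left (g := ψ) hx)

theorem exists_vanishesOn_of_notMem_support {f : CompactDistribution d} {x : Euc d}
    (hx : x ∉ f.support) : ∃ U, IsOpen U ∧ x ∈ U ∧ f.VanishesOn U := by
  rw [CompactDistribution.support, Distribution.notMem_dsupport_iff] at hx
  obtain ⟨s, hs, hso, hxs⟩ := hx
  refine ⟨s ∩ Metric.ball x 1, hso.inter Metric.isOpen_ball,
    ⟨hxs, Metric.mem_ball_self one_pos⟩, fun ψ hψ => ?_⟩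
  have hc : HasCompactSupport ψ := HasCompactSupport.of_support_subset_isCompact
    (isCompact_closedBall x 1)
    ((subset_tsupport _).trans (hψ.trans (inter_subset_right.trans Metric.ball_subset_closedBall)))
  let φ : 𝓓((⊤ : Opens (Euc d)), ℂ) := ⟨ψ, ψ.contDiff, hc, fun _ _ => trivial⟩
  exact hs φ (hψ.trans inter_subset_left)

/-- The support determines `f` locally: `f` vanishes on the smooth functions that vanish near the
support of `f`. -/
theorem vanishesOn_compl_support (f : CompactDistribution d) : f.VanishesOn f.supportᶜ := by
  intro ψ hψ
  obtain ⟨K, hK, hfK⟩ := f.exists_vanishesOn_compl_compact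
  have hT : IsCompact (K ∩ tsupport ψ) := hK.inter_right (isClosed_tsupport ψ)
  obtain ⟨U, hUo, hTU, hU⟩ : ∃ U, IsOpen U ∧ K ∩ tsupport ψ ⊆ U ∧ f.VanishesOn U := by
    refine hT.induction_on (p := fun T => ∃ U, IsOpen U ∧ T ⊆ U ∧ f.VanishesOn U) ?_ ?_ ?_ ?_
    · exact ⟨∅, isOpen_empty, Subset.rfl, fun φ hφ => by
        have : φ = 0 := by
          ext x
          by_contra h
          exact hφ (subset_tsupport _ h)
        rw [this, map_zero]⟩
    · rintro S T hST ⟨U, h1, h2, h3⟩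
      exact ⟨U, h1, hST.trans h2, h3⟩
    · rintro S T ⟨U, h1, h2, h3⟩ ⟨U', h1', h2', h3'⟩
      exact ⟨U ∪ U', h1.union h1', union_subset_union h2 h2', h3.union h1 h1' h3'⟩
    · intro x hx
      obtain ⟨U, h1, h2, h3⟩ := exists_vanishesOn_of_notMem_support (hψ hx.2)
      exact ⟨U, mem_nhdsWithin_of_mem_nhds (h1.mem_nhds h2), U, h1, Subset.rfl, h3⟩
  refine (hU.union hUo hK.isClosed.isOpen_compl hfK) ψ fun x hx => ?_
  by_cases hxK : x ∈ K
  · exact Or.inl (hTU ⟨hxK, hx⟩)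
  · exact Or.inr hxK

/-- Two smooth functions that agree on an open set containing the support of `f` have the same
image under `f`. -/
theorem congr_of_eqOn {f : CompactDistribution d} {U : Set (Euc d)} (hU : IsOpen U)
    (hf : f.support ⊆ U) {ψ χ : SmoothFunction d} (h : ∀ x ∈ U, ψ x = χ x) : f ψ = f χ := by
  rw [← sub_eq_zero, ← map_sub]
  refine f.vanishesOn_compl_support _ fun x hx hxf => ?_
  refine absurd hx ?_
  rw [notMem_tsupport_iff_eventuallyEq]
  filter_upwards [hU.mem_nhds (hf hxf)] with y hy
  simp [h y hy]

end CompactDistribution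

end Locality

/-! ### Smooth functions whose small translates are annihilated -/

section Translates

variable {d : ℕ}

namespace SmoothFunction

theorem contDiff_sub_family (g : SmoothFunction d) :
    ContDiff ℝ ∞ (fun p : Euc d × Euc d => g (p.1 - p.2)) :=
  g.contDiff.comp (contDiff_fst.sub contDiff_snd)

/-- The translate `x ↦ g (x - a)`. -/
def translate (g : SmoothFunction d) (a : Euc d) : SmoothFunction d :=
  sliceFunction _ g.contDiff_sub_family a

@[simp] theorem translate_apply (g : SmoothFunction d) (a x : Euc d) :
    g.translate a x = g (x - a) := rfl

/-- The derivative of `g` in the direction `v`. -/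
def dirDeriv (v : Euc d) (g : SmoothFunction d) : SmoothFunction d :=
  SmoothFunction.mk (fun x => fderiv ℝ g x v)
    ((g.contDiff.fderiv_right (m := ∞) (by simp)).clm_apply contDiff_const)

end SmoothFunction

namespace CompactDistribution

/-- The smooth functions `g` such that `f` annihilates all translates of `g` by vectors of norm
less than `ε`; that is, the convolution of `f` with the reflection of `g` vanishes on the ball of radius
`ε`. -/
def annihilated (f : CompactDistribution d) (ε : ℝ) : Submodule ℂ (SmoothFunction d) where
  carrier := {g | ∀ a : Euc d, ‖a‖ < ε → f (g.translate a) = 0}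
  add_mem' {g h} hg hh a ha := by
    have : (g + h).translate a = g.translate a + h.translate a := rfl
    rw [this, map_add, hg a ha, hh a ha, add_zero]
  zero_mem' a _ := by
    have : (0 : SmoothFunction d).translate a = 0 := rfl
    rw [this, map_zero]
  smul_mem' c g hg a ha := by
    have : (c • g).translate a = c • g.translate a := rfl
    rw [this, map_smul, hg a ha, smul_zero]

variable {f : CompactDistribution d} {ε : ℝ}

theorem dirDeriv_mem_annihilated {g : SmoothFunction d} (hg : g ∈ f.annihilated ε) (v : Euc d) :
    g.dirDeriv v ∈ f.annihilated ε := by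
  intro a ha
  let G : Euc d × ℝ → ℂ := fun p => g.dirDeriv v (p.1 - (a + p.2 • v))
  have hG : ContDiff ℝ ∞ G := (g.dirDeriv v).contDiff.comp
    (contDiff_fst.sub (contDiff_const.add (contDiff_snd.smul contDiff_const)))
  set J : ℝ → ℂ := fun t => f (sliceFunction G hG t) with hJ
  have hJc : Continuous J := f.continuous_apply_slice hG
  have hJ0 : J 0 = f ((g.dirDeriv v).translate a) := by
    refine congrArg f (SmoothFunction.ext fun x => ?_)
    change g.dirDeriv v (x - (a + (0 : ℝ) • v)) = g.dirDeriv v (x - a)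
    rw [zero_smul, add_zero]
  rw [← hJ0]
  have hev : ∀ᶠ τ in 𝓝 (0 : ℝ), ‖a + τ • v‖ < ε := by
    have : Continuous fun τ : ℝ => ‖a + τ • v‖ := by fun_prop
    exact this.continuousAt.eventually_lt_const (by simpa using ha)
  -- `g (x - a) - g (x - a - τ v)` is the integral of the derivative over the segment
  have hint : ∀ τ : ℝ, 0 ≤ τ → ‖a + τ • v‖ < ε → ∫ t in (0 : ℝ)..τ, J t = 0 := by
    intro τ hτ haτ
    rw [intervalIntegral.integral_of_le hτ, ← integral_Icc_eq_integral_Ioc,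
      ← f.apply_setIntegral hG isCompact_Icc]
    have e : SmoothFunction.mk _ (contDiff_setIntegral (μ := volume) (s := Icc (0 : ℝ) τ) hG
        isCompact_Icc) = g.translate a - g.translate (a + τ • v) := by
      ext x
      simp only [SmoothFunction.mk_apply, SmoothFunction.sub_apply,
        SmoothFunction.translate_apply]
      rw [integral_Icc_eq_integral_Ioc, ← intervalIntegral.integral_of_le hτ]
      have hd : ∀ t ∈ uIcc 0 τ, HasDerivAt (fun t : ℝ => -g (x - (a + t • v))) (G (x, t)) t := by
        intro t _
        have h1 : HasDerivAt (fun t : ℝ => x - (a + t • v)) (-v) t := by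
          simpa using (((hasDerivAt_id t).smul_const v).const_add a).const_sub x
        have h2 := ((g.contDiff.differentiable (by simp)) (x - (a + t • v))).hasFDerivAt
        have h3 := (h2.comp_hasDerivAt t h1).neg
        rw [map_neg, neg_neg] at h3
        exact h3
      rw [intervalIntegral.integral_eq_sub_of_hasDerivAt hd
        ((hG.continuous.comp (Continuous.prodMk_right x)).intervalIntegrable _ _)]
      simp only [zero_smul, add_zero]
      ring
    rw [e, map_sub, hg a ha, hg _ haτ, sub_zero]
  have h1 : HasDerivWithinAt (fun τ => ∫ t in (0 : ℝ)..τ, J t) (J 0) (Ici 0) 0 :=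
    (intervalIntegral.integral_hasDerivAt_right (hJc.intervalIntegrable _ _)
      hJc.aestronglyMeasurable.stronglyMeasurableAtFilter hJc.continuousAt).hasDerivWithinAt
  have h2 : HasDerivWithinAt (fun τ => ∫ t in (0 : ℝ)..τ, J t) 0 (Ici 0) 0 := by
    refine (hasDerivWithinAt_const (0 : ℝ) (Ici 0) (0 : ℂ)).congr_of_eventuallyEq ?_ (by simp)
    filter_upwards [mem_nhdsWithin_of_mem_nhds hev, self_mem_nhdsWithin] with τ h h'
    exact hint τ h' h
  exact (uniqueDiffOn_Ici (0 : ℝ) 0 self_mem_Ici).eq_deriv _ h1 h2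

/-- Membership of `g` depends only on the values of `g` outside a ball. -/
theorem mem_annihilated_congr {ρ R : ℝ} (hf : ∀ x ∈ f.support, R ≤ ‖x‖) (hρ : ρ + ε < R)
    {g h : SmoothFunction d} (hgh : ∀ y, ρ < ‖y‖ → g y = h y) (hg : g ∈ f.annihilated ε) :
    h ∈ f.annihilated ε := by
  intro a ha
  rw [← hg a ha]
  refine congr_of_eqOn (U := {x | ρ + ε < ‖x‖}) (isOpen_lt continuous_const continuous_norm)
    (fun x hx => hρ.trans_le (hf x hx)) fun x hx => ?_
  rw [SmoothFunction.translate_apply, SmoothFunction.translate_apply, hgh]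
  have h1 : ρ + ε < ‖x‖ := hx
  have h2 := norm_sub_norm_le x a
  linarith

end CompactDistribution

end Translates

/-! ### Powers of the norm times polynomials -/

section Kernels

variable {d : ℕ}

/-- A smooth positive function that equals `‖y‖ ^ 2` where `ρ ≤ ‖y‖`. -/
def regSq (ρ : ℝ) (y : Euc d) : ℝ := ‖y‖ ^ 2 + Real.smoothTransition (1 - ‖y‖ ^ 2 / ρ ^ 2)

theorem regSq_pos (ρ : ℝ) (y : Euc d) : 0 < regSq ρ y := by
  have h := Real.smoothTransition.nonneg (1 - ‖y‖ ^ 2 / ρ ^ 2)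
  rcases eq_or_ne y 0 with rfl | hy
  · simp [regSq]
  · have : 0 < ‖y‖ := norm_pos_iff.2 hy
    unfold regSq
    positivity

theorem regSq_eq {ρ : ℝ} (hρ : 0 < ρ) {y : Euc d} (hy : ρ ≤ ‖y‖) : regSq ρ y = ‖y‖ ^ 2 := by
  rw [regSq, Real.smoothTransition.zero_of_nonpos, add_zero]
  rw [sub_nonpos, one_le_div (by positivity)]
  gcongr

theorem contDiff_regSq (ρ : ℝ) : ContDiff ℝ ∞ (regSq ρ : Euc d → ℝ) :=
  (contDiff_norm_sq ℝ).add (Real.smoothTransition.contDiff.comp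
    (contDiff_const.sub ((contDiff_norm_sq ℝ).div_const _)))

theorem contDiff_regSq_rpow (ρ s : ℝ) : ContDiff ℝ ∞ (fun y : Euc d => regSq ρ y ^ s) :=
  (contDiff_regSq ρ).rpow_const_of_ne fun y => (regSq_pos ρ y).ne'

theorem regSq_neg (ρ : ℝ) (y : Euc d) : regSq ρ (-y) = regSq ρ y := by simp [regSq]

/-- The value of a polynomial in `d` variables at a vector. -/
def polyEval (q : MvPolynomial (Fin d) ℝ) (y : Euc d) : ℝ := MvPolynomial.eval (fun i => y i) q

theorem hasFDerivAt_polyEval (q : MvPolynomial (Fin d) ℝ) (y : Euc d) :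
    HasFDerivAt (polyEval q)
      (∑ i, polyEval (MvPolynomial.pderiv i q) y • (EuclideanSpace.proj i : Euc d →L[ℝ] ℝ)) y := by
  induction q using MvPolynomial.induction_on with
  | C a =>
    have : polyEval (MvPolynomial.C a : MvPolynomial (Fin d) ℝ) = fun _ => a := by
      funext z; simp [polyEval]
    rw [this]
    simpa [polyEval] using hasFDerivAt_const a y
  | add p q hp hq =>
    have : polyEval (p + q) = fun z => polyEval p z + polyEval q z := by
      funext z; simp [polyEval]
    rw [this]
    refine (hp.add hq).congr_fderiv ?_
    rw [← Finset.sum_add_distrib]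
    refine Finset.sum_congr rfl fun i _ => ?_
    simp [polyEval, add_smul]
  | mul_X p j hp =>
    have : polyEval (p * MvPolynomial.X j) = fun z => polyEval p z * z j := by
      funext z; simp [polyEval]
    rw [this]
    refine (hp.mul (EuclideanSpace.proj j : Euc d →L[ℝ] ℝ).hasFDerivAt).congr_fderiv ?_
    ext v
    simp only [add_apply, smul_apply,
      sum_apply, polyEval, Derivation.leibniz, MvPolynomial.pderiv_X,
      map_add, smul_eq_mul, map_mul, MvPolynomial.eval_X, add_mul, Finset.sum_add_distrib,
      Finset.mul_sum]
    congr 1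
    · rw [Finset.sum_eq_single j]
      · simp
      · intro b _ hb
        simp [hb.symm]
      · simp
    · refine Finset.sum_congr rfl fun i _ => ?_
      simp only [PiLp.proj_apply]
      ring

theorem contDiff_polyEval (q : MvPolynomial (Fin d) ℝ) : ContDiff ℝ ∞ (polyEval q) := by
  induction q using MvPolynomial.induction_on with
  | C a =>
    have : polyEval (MvPolynomial.C a : MvPolynomial (Fin d) ℝ) = fun _ => a := by
      funext z; simp [polyEval]
    rw [this]
    exact contDiff_const
  | add p q hp hq =>
    have : polyEval (p + q) = fun z => polyEval p z + polyEval q z := by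
      funext z; simp [polyEval]
    rw [this]
    exact hp.add hq
  | mul_X p j hp =>
    have : polyEval (p * MvPolynomial.X j) = fun z => polyEval p z * z j := by
      funext z; simp [polyEval]
    rw [this]
    exact hp.mul (EuclideanSpace.proj j : Euc d →L[ℝ] ℝ).contDiff

theorem polyEval_smul {q : MvPolynomial (Fin d) ℝ} {n : ℕ} (hq : q.IsHomogeneous n) (r : ℝ)
    (y : Euc d) : polyEval q (r • y) = r ^ n * polyEval q y := by
  simp only [polyEval, MvPolynomial.eval_eq', Finset.mul_sum]
  refine Finset.sum_congr rfl fun m hm => ?_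
  have h : ∑ i, m i = n := by
    rw [← Finsupp.degree_eq_sum, Finsupp.degree_eq_weight_one]
    exact hq (MvPolynomial.mem_support_iff.1 hm)
  simp only [PiLp.smul_apply, smul_eq_mul, mul_pow, Finset.prod_mul_distrib,
    Finset.prod_pow_eq_pow_sum, h]
  ring

/-- The polynomial `∑ Xᵢ²`. -/
def normSqPoly (d : ℕ) : MvPolynomial (Fin d) ℝ := ∑ i, MvPolynomial.X i ^ 2

theorem polyEval_normSqPoly (y : Euc d) : polyEval (normSqPoly d) y = ‖y‖ ^ 2 := by
  simp [polyEval, normSqPoly, EuclideanSpace.norm_sq_eq]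

/-- The function `y ↦ ‖y‖ ^ (2 * s) * q y`, modified inside the ball of radius `ρ` so as to be
smooth. -/
def kernelFn (ρ s : ℝ) (q : MvPolynomial (Fin d) ℝ) : SmoothFunction d :=
  SmoothFunction.mk (fun y => ((regSq ρ y ^ s * polyEval q y : ℝ) : ℂ))
    (Complex.ofRealCLM.contDiff.comp ((contDiff_regSq_rpow ρ s).mul (contDiff_polyEval q)))

theorem kernelFn_apply (ρ s : ℝ) (q : MvPolynomial (Fin d) ℝ) (y : Euc d) :
    kernelFn ρ s q y = ((regSq ρ y ^ s * polyEval q y : ℝ) : ℂ) := rfl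

theorem kernelFn_add (ρ s : ℝ) (p q : MvPolynomial (Fin d) ℝ) :
    kernelFn ρ s (p + q) = kernelFn ρ s p + kernelFn ρ s q := by
  ext y
  simp only [kernelFn_apply, SmoothFunction.add_apply, polyEval, map_add]
  push_cast
  ring

theorem kernelFn_smul (ρ s c : ℝ) (q : MvPolynomial (Fin d) ℝ) :
    kernelFn ρ s (c • q) = (c : ℂ) • kernelFn ρ s q := by
  ext y
  simp only [kernelFn_apply, SmoothFunction.smul_apply, polyEval, MvPolynomial.smul_eval]
  push_cast
  ring

theorem kernelFn_normSqPoly_mul {ρ : ℝ} (hρ : 0 < ρ) (s : ℝ) (q : MvPolynomial (Fin d) ℝ)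
    {y : Euc d} (hy : ρ < ‖y‖) :
    kernelFn ρ s (normSqPoly d * q) y = kernelFn ρ (s + 1) q y := by
  have h : polyEval (normSqPoly d * q) y = ‖y‖ ^ 2 * polyEval q y := by
    rw [← polyEval_normSqPoly]; simp [polyEval]
  rw [kernelFn_apply, kernelFn_apply, h, Real.rpow_add (regSq_pos ρ y), Real.rpow_one,
    regSq_eq hρ hy.le, mul_assoc]

theorem dirDeriv_kernelFn {ρ : ℝ} (hρ : 0 < ρ) (s : ℝ) (q : MvPolynomial (Fin d) ℝ) (i : Fin d)
    {y : Euc d} (hy : ρ < ‖y‖) :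
    (kernelFn ρ s q).dirDeriv (EuclideanSpace.single i 1) y =
      kernelFn ρ (s - 1) ((2 * s) • (MvPolynomial.X i * q) +
        normSqPoly d * MvPolynomial.pderiv i q) y := by
  have h1 : HasFDerivAt (regSq ρ) (2 • (innerSL ℝ y)) y := by
    refine (hasStrictFDerivAt_norm_sq y).hasFDerivAt.congr_of_eventuallyEq ?_
    filter_upwards [continuous_norm.continuousAt.eventually_const_lt hy] with z hz
    exact regSq_eq hρ hz.le
  have h2 := (h1.rpow_const (p := s) (Or.inl (regSq_pos ρ y).ne')).mul (hasFDerivAt_polyEval q y)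
  have h3 := (Complex.ofRealCLM.hasFDerivAt (x := regSq ρ y ^ s * polyEval q y)).comp y h2
  have h4 : (kernelFn ρ s q).dirDeriv (EuclideanSpace.single i 1) y =
      fderiv ℝ (Complex.ofRealCLM ∘ ((fun y => regSq ρ y ^ s) * polyEval q)) y
        (EuclideanSpace.single i 1) := rfl
  have h5 : polyEval ((2 * s) • (MvPolynomial.X i * q) + normSqPoly d * MvPolynomial.pderiv i q) y =
      2 * s * (y i * polyEval q y) + ‖y‖ ^ 2 * polyEval (MvPolynomial.pderiv i q) y := by
    rw [← polyEval_normSqPoly]; simp [polyEval, MvPolynomial.smul_eval]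
  have h6 : regSq ρ y ^ s = regSq ρ y ^ (s - 1) * ‖y‖ ^ 2 := by
    rw [← regSq_eq hρ hy.le, ← Real.rpow_add_one (regSq_pos ρ y).ne', sub_add_cancel]
  have h7 : ∑ j, polyEval (MvPolynomial.pderiv j q) y *
      (EuclideanSpace.single i (1 : ℝ) : Euc d) j = polyEval (MvPolynomial.pderiv i q) y := by
    rw [Finset.sum_eq_single i] <;> simp +contextual
  have h8 : inner ℝ y (EuclideanSpace.single i (1 : ℝ)) = y i := by
    simp [EuclideanSpace.inner_single_right]
  rw [h4, h3.fderiv, kernelFn_apply, h5]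
  simp only [ContinuousLinearMap.comp_apply, add_apply,
    smul_apply, sum_apply, Complex.ofRealCLM_apply,
    smul_eq_mul, innerSL_apply_apply, h8, PiLp.proj_apply, h7, nsmul_eq_mul]
  congr 1
  rw [h6]
  push_cast
  ring

end Kernels

/-! ### Integration in polar coordinates -/

section Polar

variable {d : ℕ}

/-- Integration in polar coordinates, together with the integrability of the integral over rays. -/
theorem integral_polar (hd : 0 < d) {h : Euc d → ℂ} (hh : Integrable h) :
    Integrable (fun θ : Metric.sphere (0 : Euc d) 1 =>
      ∫ r in Ioi (0 : ℝ), (r : ℂ) ^ (d - 1) * h (r • (θ : Euc d))) (sphereMeasure d) ∧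
    ∫ x, h x = ∫ θ : Metric.sphere (0 : Euc d) 1,
      (∫ r in Ioi (0 : ℝ), (r : ℂ) ^ (d - 1) * h (r • (θ : Euc d))) ∂(sphereMeasure d) := by
  have : Nonempty (Fin d) := ⟨⟨0, hd⟩⟩
  have : Nontrivial (Euc d) := inferInstance
  have hmp := (volume : Measure (Euc d)).measurePreserving_homeomorphUnitSphereProd
  have hemb := (homeomorphUnitSphereProd (Euc d)).measurableEmbedding
  have hdim : Module.finrank ℝ (Euc d) = d := finrank_euclideanSpace_fin
  rw [hdim] at hmp
  let k : Metric.sphere (0 : Euc d) 1 × Ioi (0 : ℝ) → ℂ := fun p => h ((p.2 : ℝ) • (p.1 : Euc d))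
  have hk : ∀ x, k (homeomorphUnitSphereProd (Euc d) x) = h x := by
    intro x
    have := congrArg Subtype.val ((homeomorphUnitSphereProd (Euc d)).symm_apply_apply x)
    rw [homeomorphUnitSphereProd_symm_apply_coe] at this
    exact congrArg h this
  have hki : Integrable k ((sphereMeasure d).prod (Measure.volumeIoiPow (d - 1))) := by
    unfold sphereMeasure
    rw [← hmp.integrable_comp_emb hemb]
    have h1 : IntegrableOn h ({0}ᶜ : Set (Euc d)) := hh.integrableOn
    rw [integrableOn_iff_comap_subtypeVal (measurableSet_singleton _).compl] at h1
    exact h1.congr (Eventually.of_forall fun x => (hk x).symm)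
  have hray : ∀ θ : Metric.sphere (0 : Euc d) 1,
      ∫ r, k (θ, r) ∂(Measure.volumeIoiPow (d - 1)) =
        ∫ r in Ioi (0 : ℝ), (r : ℂ) ^ (d - 1) * h (r • (θ : Euc d)) := by
    intro θ
    simp only [Measure.volumeIoiPow, ENNReal.ofReal]
    rw [integral_withDensity_eq_integral_smul
      ((measurable_subtype_coe.pow_const _).real_toNNReal),
      integral_subtype_comap measurableSet_Ioi
        fun a : ℝ => Real.toNNReal (a ^ (d - 1)) • h (a • (θ : Euc d))]
    refine setIntegral_congr_fun measurableSet_Ioi fun r hr => ?_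
    simp only [NNReal.smul_def, Real.coe_toNNReal _ (pow_nonneg (le_of_lt hr) _), Complex.real_smul]
    push_cast
    rfl
  constructor
  · refine hki.integral_prod_left.congr (Eventually.of_forall fun θ => ?_)
    exact hray θ
  · calc ∫ x, h x = ∫ x : ({(0)}ᶜ : Set (Euc d)), h x ∂((volume : Measure (Euc d)).comap (↑)) := by
          rw [integral_subtype_comap (measurableSet_singleton _).compl h, restrict_compl_singleton]
      _ = ∫ p, k p ∂((sphereMeasure d).prod (Measure.volumeIoiPow (d - 1))) := by
          unfold sphereMeasure
          rw [← hmp.integral_comp hemb]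
          simp only [hk]
      _ = _ := by
          rw [integral_prod _ hki]
          simp only [hray]

end Polar

/-! ### Averages over lines of test functions supported in a small ball -/

section LineAverages

variable {d : ℕ} {ε : ℝ} {φ : Euc d → ℝ}

theorem eq_zero_of_le_norm (hφs : tsupport φ ⊆ Metric.ball 0 ε) {x : Euc d} (hx : ε ≤ ‖x‖) :
    φ x = 0 := by
  refine image_eq_zero_of_notMem_tsupport fun h => ?_
  have := hφs h
  rw [mem_ball_zero_iff] at this
  linarith

/-- The function `(z, θ) ↦ q θ ∫ φ (z + t θ) dt` on the space of lines. As `φ` is supported in the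
ball of radius `ε` and `z ⟂ θ`, it suffices to integrate over `[-ε, ε]`. -/
def weightedXRay (ε : ℝ) (q : MvPolynomial (Fin d) ℝ) (φ : Euc d → ℝ) (hφ : ContDiff ℝ ∞ φ) :
    LineFunction d :=
  ⟨fun γ => (polyEval q γ.1.2 : ℂ) * ∫ t in Icc (-ε) ε, (φ (γ.1.1 + t • γ.1.2) : ℂ), univ,
    fun p => (polyEval q p.2 : ℂ) * ∫ t in Icc (-ε) ε, (φ (p.1 + t • p.2) : ℂ), isOpen_univ,
    fun _ => mem_univ _, by
      refine ContDiff.contDiffOn (ContDiff.mul ?_ ?_)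
      · exact Complex.ofRealCLM.contDiff.comp ((contDiff_polyEval q).comp contDiff_snd)
      · exact contDiff_setIntegral (E := Euc d × Euc d) (A := ℝ)
          (G := fun p => (φ (p.1.1 + p.2 • p.1.2) : ℂ))
          (Complex.ofRealCLM.contDiff.comp (hφ.comp
            (contDiff_fst.fst.add (contDiff_snd.smul contDiff_fst.snd)))) isCompact_Icc,
    fun _ => rfl⟩

theorem tsupport_weightedXRay (q : MvPolynomial (Fin d) ℝ) (hφ : ContDiff ℝ ∞ φ)
    (hφc : HasCompactSupport φ) (hφs : tsupport φ ⊆ Metric.ball 0 ε) :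
    HasCompactSupport (weightedXRay ε q φ hφ).1 ∧
      tsupport (weightedXRay ε q φ hφ).1 ⊆ linesMeeting (Metric.ball 0 ε) := by
  let m : Euc d × ℝ × Euc d → Euc d × Euc d := fun p => (p.1 - p.2.1 • p.2.2, p.2.2)
  have hm : Continuous m := by fun_prop
  let C : Set (Euc d × Euc d) :=
    m '' (tsupport φ ×ˢ (Icc (-ε) ε ×ˢ Metric.sphere (0 : Euc d) 1))
  have hC : IsCompact C := (hφc.prod (isCompact_Icc.prod (isCompact_sphere _ _))).image hm
  have hclosed : IsClosed {p : Euc d × Euc d | ‖p.2‖ = 1 ∧ inner ℝ p.1 p.2 = 0} :=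
    (isClosed_eq (by fun_prop) continuous_const).inter (isClosed_eq (by fun_prop) continuous_const)
  have hC' : IsCompact (Subtype.val ⁻¹' C : Set (OrientedLine d)) :=
    hclosed.isClosedEmbedding_subtypeVal.isCompact_preimage hC
  have hsub : Function.support (weightedXRay ε q φ hφ).1 ⊆ Subtype.val ⁻¹' C := by
    intro γ hγ
    have h1 : ∫ t in Icc (-ε) ε, (φ (γ.1.1 + t • γ.1.2) : ℂ) ≠ 0 := right_ne_zero_of_mul hγ
    obtain ⟨t, ht, hne⟩ : ∃ t ∈ Icc (-ε) ε, φ (γ.1.1 + t • γ.1.2) ≠ 0 := by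
      by_contra! hcon
      refine h1 (setIntegral_eq_zero_of_forall_eq_zero fun t ht => ?_)
      rw [hcon t ht, Complex.ofReal_zero]
    refine ⟨(γ.1.1 + t • γ.1.2, t, γ.1.2), ⟨subset_tsupport _ hne, ht, ?_⟩, ?_⟩
    · simpa using γ.2.1
    · simp [m]
  have hts : tsupport (weightedXRay ε q φ hφ).1 ⊆ Subtype.val ⁻¹' C :=
    closure_minimal hsub hC'.isClosed
  refine ⟨hC'.of_isClosed_subset (isClosed_tsupport _) hts, fun γ hγ => ?_⟩
  obtain ⟨⟨x, t, θ⟩, ⟨hx, -, -⟩, he⟩ := hts hγ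
  refine ⟨x, ⟨t, ?_⟩, hφs hx⟩
  have h1 : γ.1.1 = x - t • θ := (congrArg Prod.fst he).symm
  have h2 : γ.1.2 = θ := (congrArg Prod.snd he).symm
  simp [h1, h2]

theorem weightedXRay_lineThrough (q : MvPolynomial (Fin d) ℝ) (hφ : ContDiff ℝ ∞ φ)
    (hφs : tsupport φ ⊆ Metric.ball 0 ε) (x : Euc d) (θ : Metric.sphere (0 : Euc d) 1) :
    (weightedXRay ε q φ hφ).1 (lineThrough x θ) =
      (polyEval q (θ : Euc d) : ℂ) * ∫ r : ℝ, (φ (x + r • (θ : Euc d)) : ℂ) := by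
  change (polyEval q (θ : Euc d) : ℂ) * ∫ t in Icc (-ε) ε,
    (φ ((x - inner ℝ x (θ : Euc d) • (θ : Euc d)) + t • (θ : Euc d)) : ℂ) = _
  congr 1
  rw [setIntegral_eq_integral_of_forall_compl_eq_zero]
  · rw [← integral_sub_right_eq_self _ (-(inner ℝ x (θ : Euc d)))]
    refine integral_congr_ae (Eventually.of_forall fun r => ?_)
    simp only [sub_neg_eq_add, add_smul]
    congr 2
    abel
  · intro t ht
    rw [eq_zero_of_le_norm hφs, Complex.ofReal_zero]
    have hθ : ‖(θ : Euc d)‖ = 1 := by simp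
    have ho : inner ℝ (x - inner ℝ x (θ : Euc d) • (θ : Euc d)) (t • (θ : Euc d)) = 0 := by
      simp [inner_sub_left, real_inner_smul_left, real_inner_smul_right, hθ]
    have h1 := norm_add_sq_eq_norm_sq_add_norm_sq_real ho
    have h2 : ‖t • (θ : Euc d)‖ = |t| := by rw [norm_smul, hθ, mul_one, Real.norm_eq_abs]
    have h3 : ε ≤ |t| := by
      by_contra! hlt
      exact ht ⟨(abs_lt.1 hlt).1.le, (abs_lt.1 hlt).2.le⟩
    rw [h2] at h1
    nlinarith [abs_nonneg t, norm_nonneg (x - inner ℝ x (θ : Euc d) • (θ : Euc d) + t • (θ : Euc d)),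
      mul_self_nonneg ‖x - inner ℝ x (θ : Euc d) • (θ : Euc d)‖]

end LineAverages

/-! ### Kernels of degree `1 - d` -/

section Base

variable {d : ℕ} {ε ρ : ℝ} {φ : Euc d → ℝ}

/-- On rays, the kernel of degree `1 - d` cancels the Jacobian of polar coordinates. -/
theorem pow_mul_kernelFn_smul (hd : 0 < d) (hρ : 0 < ρ) {q : MvPolynomial (Fin d) ℝ} {n : ℕ}
    (hq : q.IsHomogeneous n) {r : ℝ} (hr : ρ ≤ r) (θ : Metric.sphere (0 : Euc d) 1) :
    (r : ℂ) ^ (d - 1) * kernelFn ρ ((1 - d - n) / 2) q (r • (θ : Euc d)) =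
      (polyEval q (θ : Euc d) : ℂ) := by
  have hr0 : 0 < r := hρ.trans_le hr
  have hn : ‖r • (θ : Euc d)‖ = r := by simp [norm_smul, abs_of_pos hr0]
  rw [kernelFn_apply, regSq_eq hρ (by rw [hn]; exact hr), hn, polyEval_smul hq]
  have h1 : (r ^ 2) ^ (((1 : ℝ) - d - n) / 2) = r ^ ((1 : ℝ) - d - n) := by
    rw [← Real.rpow_natCast r 2, ← Real.rpow_mul hr0.le]
    congr 1
    push_cast
    ring
  have h2 : r ^ (d - 1) * (r ^ ((1 : ℝ) - d - n) * r ^ n) = 1 := by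
    rw [← Real.rpow_natCast r (d - 1), ← Real.rpow_natCast r n, ← Real.rpow_add hr0,
      ← Real.rpow_add hr0, Nat.cast_sub hd]
    have : (d : ℝ) - (1 : ℕ) + (1 - d - n + n) = 0 := by push_cast; ring
    rw [this, Real.rpow_zero]
  rw [h1, ← Complex.ofReal_pow, ← Complex.ofReal_mul]
  congr 1
  rw [← mul_assoc (r ^ ((1 : ℝ) - d - n)), ← mul_assoc, h2, one_mul]

theorem kernelFn_neg {q : MvPolynomial (Fin d) ℝ} {n : ℕ} (hq : q.IsHomogeneous n) (hn : Even n)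
    (s : ℝ) (y : Euc d) : kernelFn ρ s q (-y) = kernelFn ρ s q y := by
  rw [kernelFn_apply, kernelFn_apply, regSq_neg, ← neg_one_smul ℝ y, polyEval_smul hq,
    hn.neg_one_pow, one_mul]

theorem integrable_mul_kernel (hφ : Continuous φ) (hφc : HasCompactSupport φ)
    (g : SmoothFunction d) (x : Euc d) : Integrable fun b => (φ (x + b) : ℂ) * g b := by
  refine Continuous.integrable_of_hasCompactSupport ?_ ?_
  · exact (Complex.continuous_ofReal.comp (hφ.comp (by fun_prop))).mul g.contDiff.continuous
  · have h1 : HasCompactSupport fun b => φ (x + b) :=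
      hφc.comp_homeomorph (Homeomorph.addLeft x)
    have h2 : HasCompactSupport fun b => (φ (x + b) : ℂ) := h1.comp_left Complex.ofReal_zero
    exact h2.mul_right

/-- Far from the origin, the adjoint of the X-ray transform of the average of `φ` over lines is
twice the convolution of `φ` with a kernel of degree `1 - d`: the two half-lines that make up a line
through `x` give equal contributions, because `n` is even. -/
theorem two_mul_integral_eq_adjoint (hd : 0 < d) (hρ : 0 < ρ) {q : MvPolynomial (Fin d) ℝ} {n : ℕ}
    (hq : q.IsHomogeneous n) (hn : Even n) (hφ : ContDiff ℝ ∞ φ) (hφc : HasCompactSupport φ)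
    (hφs : tsupport φ ⊆ Metric.ball 0 ε) {x : Euc d} (hx : ρ + ε < ‖x‖) :
    2 * ∫ a in Metric.closedBall 0 ε, (φ a : ℂ) * kernelFn ρ ((1 - d - n) / 2) q (x - a) =
      adjoint d (weightedXRay ε q φ hφ) x := by
  set g : SmoothFunction d := kernelFn ρ ((1 - d - n) / 2) q with hg
  have hneg : ∀ y, g (-y) = g y := kernelFn_neg hq hn _
  have hI : ∫ a in Metric.closedBall 0 ε, (φ a : ℂ) * g (x - a) = ∫ a, (φ a : ℂ) * g (x - a) := by
    refine setIntegral_eq_integral_of_forall_compl_eq_zero fun a ha => ?_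
    rw [mem_closedBall_zero_iff, not_le] at ha
    rw [eq_zero_of_le_norm hφs ha.le, Complex.ofReal_zero, zero_mul]
  have hp : ∫ a, (φ a : ℂ) * g (x - a) = ∫ b, (φ (x + b) : ℂ) * g b := by
    rw [← integral_add_left_eq_self _ x]
    refine integral_congr_ae (Eventually.of_forall fun b => ?_)
    simp only [sub_add_cancel_left, hneg]
  have hm : ∫ a, (φ a : ℂ) * g (x - a) = ∫ b, (φ (x + -b) : ℂ) * g (-b) := by
    rw [hp, ← integral_neg_eq_self]
  have hip := integrable_mul_kernel hφ.continuous hφc g x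
  have him : Integrable fun b => (φ (x + -b) : ℂ) * g (-b) := hip.comp_neg
  obtain ⟨hip', hep⟩ := integral_polar hd hip
  obtain ⟨him', hem⟩ := integral_polar hd him
  -- on the support of the integrand the kernel is the unmodified one
  have hray : ∀ (σ r : ℝ) (θ : Metric.sphere (0 : Euc d) 1), |σ| = 1 → 0 < r →
      (r : ℂ) ^ (d - 1) * ((φ (x + (σ * r) • (θ : Euc d)) : ℂ) * g (r • (θ : Euc d))) =
        (polyEval q (θ : Euc d) : ℂ) * (φ (x + (σ * r) • (θ : Euc d)) : ℂ) := by
    intro σ r θ hσ hr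
    by_cases h0 : φ (x + (σ * r) • (θ : Euc d)) = 0
    · simp [h0]
    · have h1 : ‖x + (σ * r) • (θ : Euc d)‖ < ε := by
        by_contra! hle
        exact h0 (eq_zero_of_le_norm hφs hle)
      have h2 : ‖(σ * r) • (θ : Euc d)‖ = r := by
        simp [norm_smul, hσ, abs_of_pos hr]
      have h3 := norm_sub_le (x + (σ * r) • (θ : Euc d)) ((σ * r) • (θ : Euc d))
      rw [add_sub_cancel_right, h2] at h3
      rw [← pow_mul_kernelFn_smul hd hρ hq (r := r) (by linarith) θ]
      ring
  have hlin : ∀ θ : Metric.sphere (0 : Euc d) 1,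
      (∫ r in Ioi (0 : ℝ), (r : ℂ) ^ (d - 1) *
        ((φ (x + r • (θ : Euc d)) : ℂ) * g (r • (θ : Euc d)))) +
      (∫ r in Ioi (0 : ℝ), (r : ℂ) ^ (d - 1) *
        ((φ (x + -(r • (θ : Euc d))) : ℂ) * g (-(r • (θ : Euc d))))) =
      (weightedXRay ε q φ hφ).1 (lineThrough x θ) := by
    intro θ
    have hθ : ‖(θ : Euc d)‖ = 1 := by simp
    have hθ0 : (θ : Euc d) ≠ 0 := by
      intro h
      rw [h, norm_zero] at hθ
      exact zero_ne_one hθ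
    have hint : Integrable fun r : ℝ => (φ (x + r • (θ : Euc d)) : ℂ) := by
      refine Continuous.integrable_of_hasCompactSupport
        (Complex.continuous_ofReal.comp (hφ.continuous.comp (by fun_prop))) ?_
      have h1 : HasCompactSupport fun r : ℝ => φ (x + r • (θ : Euc d)) :=
        hφc.comp_isClosedEmbedding
          ((Homeomorph.addLeft x).isClosedEmbedding.comp (isClosedEmbedding_smul_left hθ0))
      exact h1.comp_left Complex.ofReal_zero
    rw [weightedXRay_lineThrough q hφ hφs, ← intervalIntegral.integral_Iic_add_Ioi
      (b := 0) hint.integrableOn hint.integrableOn, mul_add, add_comm]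
    congr 1
    · rw [← integral_const_mul, ← neg_zero, ← integral_comp_neg_Ioi]
      rw [neg_zero]
      refine setIntegral_congr_fun measurableSet_Ioi fun r hr => ?_
      have := hray (-1) r θ (by simp) hr
      simp only [neg_mul, one_mul, neg_smul] at this
      simp only [hneg, neg_smul]
      exact this
    · rw [← integral_const_mul]
      refine setIntegral_congr_fun measurableSet_Ioi fun r hr => ?_
      have := hray 1 r θ (by simp) hr
      simpa only [one_mul] using this
  calc 2 * ∫ a in Metric.closedBall 0 ε, (φ a : ℂ) * g (x - a)
      = (∫ b, (φ (x + b) : ℂ) * g b) + ∫ b, (φ (x + -b) : ℂ) * g (-b) := by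
        rw [hI, ← hm, ← hp]; ring
    _ = ∫ θ : Metric.sphere (0 : Euc d) 1, (weightedXRay ε q φ hφ).1 (lineThrough x θ)
          ∂(sphereMeasure d) := by
        rw [hep, hem, ← integral_add hip' him']
        exact integral_congr_ae (Eventually.of_forall hlin)
    _ = _ := rfl

/-- If `f` integrates to zero over the lines that meet the ball of radius `ε`, then it annihilates
the small translates of the even kernels of degree `1 - d`. -/
theorem kernelFn_mem_annihilated {f : CompactDistribution d} {R : ℝ} (hd : 0 < d) (hρ : 0 < ρ)
    (hf : ∀ x ∈ f.support, R ≤ ‖x‖) (hρR : ρ + ε < R)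
    (hX : VanishesOnLinesMeeting f (Metric.ball 0 ε))
    {q : MvPolynomial (Fin d) ℝ} {n : ℕ} (hq : q.IsHomogeneous n) (hn : Even n) :
    kernelFn ρ ((1 - d - n) / 2) q ∈ f.annihilated ε := by
  set g : SmoothFunction d := kernelFn ρ ((1 - d - n) / 2) q with hg
  have hJc : Continuous fun a => f (g.translate a) :=
    f.continuous_apply_slice g.contDiff_sub_family
  have hae : ∀ᵐ a : Euc d, a ∈ Metric.ball (0 : Euc d) ε → f (g.translate a) = 0 := by
    refine Metric.isOpen_ball.ae_eq_zero_of_integral_contDiff_smul_eq_zero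
      (hJc.locallyIntegrable.locallyIntegrableOn _) fun φ hφ hφc hφs => ?_
    have hφ' : ContDiff ℝ ∞ φ := hφ
    have hG : ContDiff ℝ ∞ (fun p : Euc d × Euc d => (φ p.2 : ℂ) * g (p.1 - p.2)) :=
      (Complex.ofRealCLM.contDiff.comp (hφ'.comp contDiff_snd)).mul g.contDiff_sub_family
    have h1 : ∫ a, φ a • f (g.translate a) =
        ∫ a in Metric.closedBall 0 ε, f (sliceFunction _ hG a) := by
      rw [← setIntegral_eq_integral_of_forall_compl_eq_zero (s := Metric.closedBall 0 ε)]
      · refine integral_congr_ae (Eventually.of_forall fun a => ?_)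
        have : sliceFunction _ hG a = (φ a : ℂ) • g.translate a := rfl
        simp only [this, map_smul, Complex.real_smul, smul_eq_mul]
      · intro a ha
        rw [mem_closedBall_zero_iff, not_le] at ha
        rw [eq_zero_of_le_norm hφs ha.le, zero_smul]
    rw [h1, ← f.apply_setIntegral hG (isCompact_closedBall _ _)]
    obtain ⟨hη1, hη2⟩ := tsupport_weightedXRay (ε := ε) q hφ' hφc hφs
    have h2 : f ((2 : ℂ) • SmoothFunction.mk _ (contDiff_setIntegral (μ := volume)
        (s := Metric.closedBall 0 ε) hG (isCompact_closedBall _ _))) =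
        f (adjoint d (weightedXRay ε q φ hφ')) := by
      refine CompactDistribution.congr_of_eqOn (U := {x | ρ + ε < ‖x‖})
        (isOpen_lt continuous_const continuous_norm) (fun x hx => hρR.trans_le (hf x hx))
        fun x hx => ?_
      rw [← two_mul_integral_eq_adjoint hd hρ hq hn hφ' hφc hφs hx]
      rfl
    have h3 : f (adjoint d (weightedXRay ε q φ hφ')) = 0 := hX _ hη1 hη2
    rw [h3, map_smul, smul_eq_zero] at h2
    exact h2.resolve_left two_ne_zero
  intro a ha
  have h := Measure.eqOn_open_of_ae_eq (μ := volume) (U := Metric.ball (0 : Euc d) ε)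
    (f := fun a => f (g.translate a)) (g := fun _ => (0 : ℂ))
    ((ae_restrict_iff' measurableSet_ball).2 hae)
    Metric.isOpen_ball hJc.continuousOn continuousOn_const
  exact h (by simpa using ha)

end Base

/-! ### All degrees of homogeneity -/

section Degrees

open MvPolynomial

variable {d : ℕ}

theorem sum_X_mul_X_mul (q : MvPolynomial (Fin d) ℝ) :
    ∑ i, X i * (X i * q) = normSqPoly d * q := by
  rw [normSqPoly, Finset.sum_mul]
  exact Finset.sum_congr rfl fun i _ => by ring

theorem sum_pderiv_X_mul {q : MvPolynomial (Fin d) ℝ} {n : ℕ} (hq : q.IsHomogeneous n) :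
    ∑ i, pderiv i (X i * q) = ((d + n : ℕ) : ℝ) • q := by
  have h : ∀ i : Fin d, pderiv i (X i * q) = q + X i * pderiv i q := by
    intro i
    simp only [Derivation.leibniz, smul_eq_mul, pderiv_X_self, mul_one]
    ring
  simp only [h, Finset.sum_add_distrib, hq.sum_X_mul_pderiv, Finset.sum_const, Finset.card_univ,
    Fintype.card_fin]
  rw [← add_nsmul, Nat.cast_smul_eq_nsmul]

theorem pderiv_normSqPoly (i : Fin d) : pderiv i (normSqPoly d) = (2 : ℝ) • X i := by
  rw [normSqPoly, map_sum, Finset.sum_eq_single i]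
  · rw [pow_two, Derivation.leibniz, pderiv_X_self, smul_eq_mul, mul_one, two_smul]
  · intro j _ hj
    rw [pow_two, Derivation.leibniz, pderiv_X_of_ne hj]
    simp
  · simp

theorem isHomogeneous_normSqPoly (d : ℕ) : (normSqPoly d).IsHomogeneous 2 :=
  IsHomogeneous.sum _ _ _ fun i _ => isHomogeneous_X_pow i 2

/-- Let `M s` be the space of polynomials `q` such that `‖y‖ ^ (2 * s) * q` belongs to a class of
functions closed under differentiation (`hder`, `hmul`). If the class contains all even kernels of
degree `1 - d`, then it contains all odd kernels of degree `-d`. For the field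
`K = ‖y‖ ^ 2 ∇ (‖y‖ ^ (2 * s) * q)` has even components of degree `1 - d`, and its divergence is,
on the sphere, the spherical Laplacian of `q`; the latter has no kernel in odd degrees. -/
theorem mem_of_odd (hd : 2 ≤ d) {M : ℝ → Submodule ℝ (MvPolynomial (Fin d) ℝ)}
    (hder : ∀ s q i, q ∈ M s → (2 * s) • (X i * q) + normSqPoly d * pderiv i q ∈ M (s - 1))
    (hmul : ∀ s q, normSqPoly d * q ∈ M s ↔ q ∈ M (s + 1))
    (hbase : ∀ (n : ℕ) q, q.IsHomogeneous n → Even n → q ∈ M ((1 - d - n) / 2)) :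
    ∀ (n : ℕ) (q : MvPolynomial (Fin d) ℝ), q.IsHomogeneous n → Odd n →
      q ∈ M ((1 - d - 1 - n) / 2) := by
  intro n
  induction n using Nat.strong_induction_on with
  | _ n ih =>
  intro q hq hn
  have hn1 : 1 ≤ n := hn.pos
  set s : ℝ := (1 - d - 1 - n) / 2 with hs
  let K : Fin d → MvPolynomial (Fin d) ℝ := fun i =>
    normSqPoly d * pderiv i q + (2 * s) • (X i * q)
  have hK : ∀ i, K i ∈ M s := by
    intro i
    have h1 : (K i).IsHomogeneous (n + 1) := by
      refine IsHomogeneous.add ?_ ?_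
      · have := (isHomogeneous_normSqPoly d).mul (hq.pderiv (i := i))
        rwa [show 2 + (n - 1) = n + 1 by omega] at this
      · rw [smul_eq_C_mul, add_comm n 1]
        exact ((isHomogeneous_X ℝ i).mul hq).C_mul _
    have h2 := hbase _ _ h1 hn.add_one
    convert h2 using 2
    rw [hs]
    push_cast
    ring
  -- the Laplacian of `q`
  let L : MvPolynomial (Fin d) ℝ := ∑ i, pderiv i (pderiv i q)
  have hsum : ∑ i, ((2 * s) • (X i * K i) + normSqPoly d * pderiv i (K i)) =
      normSqPoly d * ((2 * n + 2 * s * n : ℝ) • q + normSqPoly d * L) := by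
    have e1 : ∑ i, X i * K i = (n + 2 * s : ℝ) • (normSqPoly d * q) := by
      have : ∀ i, X i * K i = normSqPoly d * (X i * pderiv i q) + (2 * s) • (X i * (X i * q)) := by
        intro i
        simp only [K, mul_add, mul_smul_comm]
        ring
      simp only [this, Finset.sum_add_distrib, ← Finset.mul_sum, ← Finset.smul_sum,
        hq.sum_X_mul_pderiv, sum_X_mul_X_mul]
      rw [← Nat.cast_smul_eq_nsmul ℝ, mul_smul_comm, ← add_smul]
    have e2 : ∑ i, pderiv i (K i) =
        (2 * n + 2 * s * (d + n) : ℝ) • q + normSqPoly d * L := by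
      have : ∀ i, pderiv i (K i) = normSqPoly d * pderiv i (pderiv i q) +
          (2 : ℝ) • (X i * pderiv i q) + (2 * s) • pderiv i (X i * q) := by
        intro i
        simp only [K, map_add, Derivation.map_smul]
        rw [Derivation.leibniz, pderiv_normSqPoly]
        simp only [smul_eq_mul, mul_comm (pderiv i q), smul_mul_assoc]
      simp only [this, Finset.sum_add_distrib, ← Finset.mul_sum, ← Finset.smul_sum,
        hq.sum_X_mul_pderiv, sum_pderiv_X_mul hq]
      rw [← Nat.cast_smul_eq_nsmul ℝ n q, smul_smul, smul_smul, add_assoc, ← add_smul, add_comm]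
      push_cast
      rfl
    rw [Finset.sum_add_distrib, ← Finset.smul_sum, ← Finset.mul_sum, e1, e2]
    simp only [mul_add, mul_smul_comm, smul_smul, ← add_assoc, ← add_smul]
    congr 2
    rw [hs]
    ring
  have h1 : normSqPoly d * ((2 * n + 2 * s * n : ℝ) • q + normSqPoly d * L) ∈ M (s - 1) := by
    rw [← hsum]
    exact Submodule.sum_mem _ fun i _ => hder s (K i) i (hK i)
  rw [hmul, sub_add_cancel] at h1
  have h2 : normSqPoly d * L ∈ M s := by
    rw [hmul]
    obtain ⟨m, hm⟩ := hn
    rcases Nat.eq_zero_or_pos m with h0 | h0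
    · have hL : L = 0 := by
        refine Finset.sum_eq_zero fun i _ => ?_
        have h3 := hq.pderiv (i := i)
        rw [show n - 1 = 0 by omega] at h3
        rw [← totalDegree_zero_iff_isHomogeneous, totalDegree_eq_zero_iff_eq_C] at h3
        rw [h3, pderiv_C]
      rw [hL]
      exact Submodule.zero_mem _
    · have hL : L.IsHomogeneous (n - 2) :=
        IsHomogeneous.sum _ _ _ fun i _ => (hq.pderiv (i := i)).pderiv (i := i)
      have h3 := ih (n - 2) (by omega) L hL ⟨m - 1, by omega⟩
      convert h3 using 2
      rw [hs, Nat.cast_sub (by omega)]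
      push_cast
      ring
  have h3 := Submodule.sub_mem _ h1 h2
  rw [add_sub_cancel_right] at h3
  refine (Submodule.smul_mem_iff _ ?_).1 h3
  have h4 : (2 * n + 2 * s * n : ℝ) = -(n * (n + d - 2)) := by rw [hs]; ring
  have h5 : (1 : ℝ) ≤ n := by exact_mod_cast hn1
  have h6 : (2 : ℝ) ≤ d := by exact_mod_cast hd
  rw [h4, neg_ne_zero]
  refine mul_ne_zero (by positivity) ?_
  have : (0 : ℝ) < n + d - 2 := by linarith
  exact this.ne'

/-- A class closed under differentiation that contains the even kernels of degree `1 - d` contains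
the kernels of degree `1 - d - k` of the parity of `k`. For `k ≥ 2` these are divergences of radial
fields, `div (y G) = (1 - k) G`; the degree `-d`, where the divergence of every radial field
vanishes, is the one treated in `mem_of_odd`. -/
theorem mem_of_parity (hd : 2 ≤ d) {M : ℝ → Submodule ℝ (MvPolynomial (Fin d) ℝ)}
    (hder : ∀ s q i, q ∈ M s → (2 * s) • (X i * q) + normSqPoly d * pderiv i q ∈ M (s - 1))
    (hmul : ∀ s q, normSqPoly d * q ∈ M s ↔ q ∈ M (s + 1))
    (hbase : ∀ (n : ℕ) q, q.IsHomogeneous n → Even n → q ∈ M ((1 - d - n) / 2)) (k : ℕ) :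
    ∀ (n : ℕ) (q : MvPolynomial (Fin d) ℝ), q.IsHomogeneous n → Even (n + k) →
      q ∈ M ((1 - d - k - n) / 2) := by
  induction k with
  | zero =>
    intro n q hq hn
    simpa using hbase n q hq hn
  | succ k ih =>
    intro n q hq hn
    rcases Nat.eq_zero_or_pos k with rfl | hk
    · have h := mem_of_odd hd hder hmul hbase n q hq (by
        rw [← Nat.not_even_iff_odd]
        intro h
        exact Nat.not_even_iff_odd.2 h.add_one hn)
      simpa using h
    set s : ℝ := (1 - d - (k + 1 : ℕ) - n) / 2 with hs
    have h1 : ∀ i, X i * q ∈ M s := by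
      intro i
      have h2 : (X i * q).IsHomogeneous (n + 1) := by
        rw [add_comm n 1]
        exact (isHomogeneous_X ℝ i).mul hq
      convert ih (n + 1) _ h2 (by rwa [add_assoc, add_comm 1 k]) using 2
      rw [hs]
      push_cast
      ring
    have h2 : ∑ i, ((2 * s) • (X i * (X i * q)) + normSqPoly d * pderiv i (X i * q)) =
        normSqPoly d * ((-k : ℝ) • q) := by
      rw [Finset.sum_add_distrib, ← Finset.smul_sum, ← Finset.mul_sum, sum_X_mul_X_mul,
        sum_pderiv_X_mul hq, mul_smul_comm, mul_smul_comm, ← add_smul]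
      congr 1
      rw [hs]
      push_cast
      ring
    have h3 : normSqPoly d * ((-k : ℝ) • q) ∈ M (s - 1) := by
      rw [← h2]
      exact Submodule.sum_mem _ fun i _ => hder s _ i (h1 i)
    rw [hmul, sub_add_cancel] at h3
    refine (Submodule.smul_mem_iff _ ?_).1 h3
    rw [neg_ne_zero]
    exact_mod_cast hk.ne'

end Degrees

section Annihilated

variable {d : ℕ} {f : CompactDistribution d} {ε ρ R : ℝ}

/-- The polynomials `q` for which the kernel `‖y‖ ^ (2 * s) * q` is annihilated. -/
def annihilatedPoly (f : CompactDistribution d) (ε ρ s : ℝ) :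
    Submodule ℝ (MvPolynomial (Fin d) ℝ) where
  carrier := {q | kernelFn ρ s q ∈ f.annihilated ε}
  add_mem' {p q} hp hq := by
    rw [mem_ofPred_eq, kernelFn_add]
    exact Submodule.add_mem _ hp hq
  zero_mem' := by
    rw [mem_ofPred_eq, ← zero_smul ℝ (0 : MvPolynomial (Fin d) ℝ), kernelFn_smul,
      Complex.ofReal_zero, zero_smul]
    exact Submodule.zero_mem _
  smul_mem' c q hq := by
    rw [mem_ofPred_eq, kernelFn_smul]
    exact Submodule.smul_mem _ _ hq

/-- The distribution annihilates the kernels `‖y‖ ^ (1 - d) * q (y / ‖y‖ ^ 2)`. -/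
theorem apply_kernelFn_eq_zero (hd : 2 ≤ d) (hε : 0 < ε) (hρ : 0 < ρ)
    (hf : ∀ x ∈ f.support, R ≤ ‖x‖) (hρR : ρ + ε < R)
    (hX : VanishesOnLinesMeeting f (Metric.ball 0 ε))
    {q : MvPolynomial (Fin d) ℝ} {n : ℕ} (hq : q.IsHomogeneous n) :
    f (kernelFn ρ ((1 - d) / 2 - n) q) = 0 := by
  have h : q ∈ annihilatedPoly f ε ρ ((1 - d - n - n) / 2) := by
    refine mem_of_parity hd (M := annihilatedPoly f ε ρ) ?_ ?_ ?_ n n q hq ⟨n, rfl⟩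
    · intro s p i hp
      exact CompactDistribution.mem_annihilated_congr hf hρR
        (fun y hy => dirDeriv_kernelFn hρ s p i hy)
        (CompactDistribution.dirDeriv_mem_annihilated hp _)
    · intro s p
      exact ⟨fun hp => CompactDistribution.mem_annihilated_congr hf hρR
          (fun y hy => kernelFn_normSqPoly_mul hρ s p hy) hp,
        fun hp => CompactDistribution.mem_annihilated_congr hf hρR
          (fun y hy => (kernelFn_normSqPoly_mul hρ s p hy).symm) hp⟩
    · intro n p hp hn
      exact kernelFn_mem_annihilated (by omega) hρ hf hρR hX hp hn
  have h0 := h 0 (by simpa using hε)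
  have e : (kernelFn ρ ((1 - d - n - n) / 2) q).translate 0 =
      kernelFn ρ ((1 - d) / 2 - n) q := by
    ext y
    rw [SmoothFunction.translate_apply, sub_zero]
    congr 2
    ring
  rwa [e] at h0

end Annihilated

/-! ### Density of polynomials in the inverted variable -/

section Inversion

open MvPolynomial

variable {d : ℕ}

/-- A smooth map that equals the inversion `y ↦ y / ‖y‖ ^ 2` where `ρ ≤ ‖y‖`. -/
def regInv (ρ : ℝ) (y : Euc d) : Euc d := (regSq ρ y)⁻¹ • y

theorem contDiff_regInv (ρ : ℝ) : ContDiff ℝ ∞ (regInv ρ : Euc d → Euc d) :=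
  ((contDiff_regSq ρ).inv fun y => (regSq_pos ρ y).ne').smul contDiff_id

theorem norm_regInv {ρ : ℝ} (hρ : 0 < ρ) {y : Euc d} (hy : ρ ≤ ‖y‖) :
    ‖regInv ρ y‖ = ‖y‖⁻¹ := by
  have : 0 < ‖y‖ := hρ.trans_le hy
  rw [regInv, regSq_eq hρ hy, norm_smul, norm_inv, norm_pow, norm_norm]
  field_simp

/-- The function `y ↦ ‖y‖ ^ (1 - d) * ψ (y / ‖y‖ ^ 2)`, made smooth near the origin. -/
def invPullback (ρ : ℝ) (ψ : Euc d → ℂ) (hψ : ContDiff ℝ ∞ ψ) : SmoothFunction d :=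
  SmoothFunction.mk (fun y => ((regSq ρ y ^ ((1 - d : ℝ) / 2) : ℝ) : ℂ) * ψ (regInv ρ y))
    ((Complex.ofRealCLM.contDiff.comp (contDiff_regSq_rpow ρ _)).mul
      (hψ.comp (contDiff_regInv ρ)))

theorem invPullback_apply (ρ : ℝ) (ψ : Euc d → ℂ) (hψ : ContDiff ℝ ∞ ψ) (y : Euc d) :
    invPullback ρ ψ hψ y = ((regSq ρ y ^ ((1 - d : ℝ) / 2) : ℝ) : ℂ) * ψ (regInv ρ y) := rfl

theorem contDiff_ofReal_polyEval (p : MvPolynomial (Fin d) ℝ) :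
    ContDiff ℝ ∞ (fun u : Euc d => (polyEval p u : ℂ)) :=
  Complex.ofRealCLM.contDiff.comp (contDiff_polyEval p)

theorem kernelFn_eq_invPullback (ρ : ℝ) {q : MvPolynomial (Fin d) ℝ} {n : ℕ}
    (hq : q.IsHomogeneous n) :
    kernelFn ρ ((1 - d) / 2 - n) q = invPullback ρ _ (contDiff_ofReal_polyEval q) := by
  ext y
  rw [kernelFn_apply, invPullback_apply, regInv, polyEval_smul hq,
    Real.rpow_sub (regSq_pos ρ y), Real.rpow_natCast, ← Complex.ofReal_mul]
  congr 1
  rw [inv_pow]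
  ring

variable {f : CompactDistribution d} {ρ : ℝ}

theorem apply_invPullback_polyEval
    (h : ∀ (n : ℕ) (q : MvPolynomial (Fin d) ℝ), q.IsHomogeneous n →
      f (kernelFn ρ ((1 - d) / 2 - n) q) = 0) (p : MvPolynomial (Fin d) ℝ) :
    f (invPullback ρ _ (contDiff_ofReal_polyEval p)) = 0 := by
  have e : invPullback ρ _ (contDiff_ofReal_polyEval p) =
      ∑ n ∈ Finset.range (p.totalDegree + 1),
        invPullback ρ _ (contDiff_ofReal_polyEval (homogeneousComponent n p)) := by
    have hsum : ∀ (t : Finset ℕ), invPullback ρ _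
        (contDiff_ofReal_polyEval (∑ n ∈ t, homogeneousComponent n p)) =
        ∑ n ∈ t, invPullback ρ _ (contDiff_ofReal_polyEval (homogeneousComponent n p)) := by
      intro t
      induction t using Finset.induction_on with
      | empty =>
        ext y
        simp [invPullback_apply, polyEval]
      | insert a t ha ih =>
        rw [Finset.sum_insert (M := SmoothFunction d) ha, ← ih]
        ext y
        simp only [invPullback_apply, SmoothFunction.add_apply, Finset.sum_insert ha, polyEval,
          map_add]
        push_cast
        ring
    rw [← hsum]
    simp only [sum_homogeneousComponent]
  rw [e, map_sum]
  refine Finset.sum_eq_zero fun n _ => ?_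
  rw [← kernelFn_eq_invPullback ρ (homogeneousComponent_isHomogeneous n p)]
  exact h n _ (homogeneousComponent_isHomogeneous n p)

/-- The polynomial `(1 - ‖u - a‖ ^ 2 / t ^ 2) ^ n` in `u`. -/
def landauPoly (t : ℝ) (n : ℕ) (a : Euc d) : MvPolynomial (Fin d) ℝ :=
  (1 - C (1 / t ^ 2) * ∑ i, (X i - C (a i)) ^ 2) ^ n

theorem polyEval_landauPoly (t : ℝ) (n : ℕ) (a u : Euc d) :
    polyEval (landauPoly t n a) u = (1 - ‖u - a‖ ^ 2 / t ^ 2) ^ n := by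
  simp only [polyEval, landauPoly, map_pow, map_sub, map_one, map_mul, map_sum, eval_C, eval_X,
    EuclideanSpace.norm_sq_eq, PiLp.sub_apply, Real.norm_eq_abs, sq_abs]
  congr 2
  ring

/-- Polynomials are dense in the smooth functions: if `f` annihilates the functions
`‖y‖ ^ (1 - d) * p (y / ‖y‖ ^ 2)` with `p` polynomial, then the same holds for every smooth `ψ` of
compact support in place of `p`. The convolution of `ψ` with the peak functions
`(1 - ‖b‖ ^ 2 / (2 * r) ^ 2) ^ n` agrees with a polynomial on the relevant ball, and these peak
functions, suitably normalized, concentrate at the origin. -/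
theorem apply_invPullback_eq_zero {r : ℝ} (hρ : 0 < ρ) (hf : ∀ x ∈ f.support, ρ < ‖x‖)
    (hr : ρ⁻¹ ≤ r)
    (h : ∀ p : MvPolynomial (Fin d) ℝ, f (invPullback ρ _ (contDiff_ofReal_polyEval p)) = 0)
    {ψ : Euc d → ℂ} (hψ : ContDiff ℝ ∞ ψ) (hψr : ∀ u, r ≤ ‖u‖ → ψ u = 0) :
    f (invPullback ρ ψ hψ) = 0 := by
  have hr0 : 0 < r := (inv_pos.2 hρ).trans_le hr
  set c : Euc d → ℝ := fun b => 1 - ‖b‖ ^ 2 / (2 * r) ^ 2 with hc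
  have hcs : ContDiff ℝ ∞ c := contDiff_const.sub ((contDiff_norm_sq ℝ).div_const _)
  have hmC : ContDiff ℝ ∞ (fun y : Euc d => ((regSq ρ y ^ ((1 - d : ℝ) / 2) : ℝ) : ℂ)) :=
    Complex.ofRealCLM.contDiff.comp (contDiff_regSq_rpow ρ _)
  have hG₀ : ContDiff ℝ ∞ (fun p : Euc d × Euc d =>
      ((regSq ρ p.1 ^ ((1 - d : ℝ) / 2) : ℝ) : ℂ) * ψ (regInv ρ p.1 - p.2)) :=
    (hmC.comp contDiff_fst).mul
      (hψ.comp (((contDiff_regInv ρ).comp contDiff_fst).sub contDiff_snd))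
  set J : Euc d → ℂ := fun b => f (sliceFunction _ hG₀ b) with hJ
  have hJc : Continuous J := f.continuous_apply_slice hG₀
  have hJ0 : J 0 = f (invPullback ρ ψ hψ) := by
    refine congrArg f (SmoothFunction.ext fun y => ?_)
    change _ * ψ (regInv ρ y - 0) = _
    rw [sub_zero, invPullback_apply]
  have hzero : ∀ n : ℕ, ∫ b in Metric.closedBall (0 : Euc d) (2 * r), c b ^ n • J b = 0 := by
    intro n
    have hG : ContDiff ℝ ∞ (fun p : Euc d × Euc d => ((c p.2 ^ n : ℝ) : ℂ) *
        (((regSq ρ p.1 ^ ((1 - d : ℝ) / 2) : ℝ) : ℂ) * ψ (regInv ρ p.1 - p.2))) :=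
      (Complex.ofRealCLM.contDiff.comp ((hcs.comp contDiff_snd).pow n)).mul hG₀
    have hH : ContDiff ℝ ∞ (fun p : Euc d × Euc d => ψ p.2 *
        (((regSq ρ p.1 ^ ((1 - d : ℝ) / 2) : ℝ) : ℂ) * ((c (regInv ρ p.1 - p.2) ^ n : ℝ) : ℂ))) :=
      (hψ.comp contDiff_snd).mul ((hmC.comp contDiff_fst).mul (Complex.ofRealCLM.contDiff.comp
        ((hcs.comp (((contDiff_regInv ρ).comp contDiff_fst).sub contDiff_snd)).pow n)))
    have h1 : ∫ b in Metric.closedBall (0 : Euc d) (2 * r), c b ^ n • J b =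
        ∫ b in Metric.closedBall (0 : Euc d) (2 * r), f (sliceFunction _ hG b) := by
      refine integral_congr_ae (Eventually.of_forall fun b => ?_)
      have : sliceFunction _ hG b = ((c b ^ n : ℝ) : ℂ) • sliceFunction _ hG₀ b := rfl
      simp only [this, map_smul, Complex.real_smul, smul_eq_mul, hJ]
    have h2 : ∀ a, f (sliceFunction _ hH a) = 0 := by
      intro a
      have e : sliceFunction _ hH a =
          ψ a • invPullback ρ _ (contDiff_ofReal_polyEval (landauPoly (2 * r) n a)) := by
        ext y
        rw [SmoothFunction.smul_apply, invPullback_apply, polyEval_landauPoly]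
        rfl
      rw [e, map_smul, h, smul_zero]
    rw [h1, ← f.apply_setIntegral hG (isCompact_closedBall _ _)]
    have h3 : f (SmoothFunction.mk _ (contDiff_setIntegral (μ := volume)
        (s := Metric.closedBall 0 r) hH (isCompact_closedBall _ _))) = 0 := by
      rw [f.apply_setIntegral hH (isCompact_closedBall _ _)]
      simp only [h2, integral_zero]
    rw [← h3]
    refine CompactDistribution.congr_of_eqOn (U := {x | ρ < ‖x‖})
      (isOpen_lt continuous_const continuous_norm) hf fun y hy => ?_
    have hy' : ρ < ‖y‖ := hy
    have hu : ‖regInv ρ y‖ ≤ r := by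
      rw [norm_regInv hρ hy'.le]
      exact (inv_anti₀ hρ hy'.le).trans hr
    simp only [SmoothFunction.mk_apply]
    rw [setIntegral_eq_integral_of_forall_compl_eq_zero,
      setIntegral_eq_integral_of_forall_compl_eq_zero,
      ← integral_sub_left_eq_self _ volume (regInv ρ y)]
    · refine integral_congr_ae (Eventually.of_forall fun b => ?_)
      simp only [sub_sub_cancel]
      ring
    · intro a ha
      rw [mem_closedBall_zero_iff, not_le] at ha
      rw [hψr a ha.le, zero_mul]
    · intro b hb
      rw [mem_closedBall_zero_iff, not_le] at hb
      have h4 := norm_sub_norm_le b (regInv ρ y)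
      rw [norm_sub_rev] at h4
      rw [hψr _ (by linarith), mul_zero, mul_zero]
  have hlim := tendsto_setIntegral_pow_smul_of_unique_maximum_of_isCompact_of_continuousOn
    (μ := (volume : Measure (Euc d))) (g := J) (x₀ := 0)
    (isCompact_closedBall (0 : Euc d) (2 * r)) (c := c)
    hcs.continuous.continuousOn ?_ ?_ ?_ ?_ hJc.continuousOn
  · simp only [hzero, smul_zero] at hlim
    rw [← hJ0]
    exact (tendsto_nhds_unique hlim tendsto_const_nhds)
  · intro b _ hb
    have : 0 < ‖b‖ := norm_pos_iff.2 hb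
    have h5 : 0 < ‖b‖ ^ 2 / (2 * r) ^ 2 := by positivity
    simp only [hc, norm_zero]
    norm_num
    exact h5
  · intro b hb
    rw [mem_closedBall_zero_iff] at hb
    simp only [hc, sub_nonneg]
    rw [div_le_one (by positivity)]
    gcongr
  · simp [hc]
  · rw [interior_closedBall _ (by positivity)]
    exact subset_closure (Metric.mem_ball_self (by positivity))

/-- The inversion is an involution away from the origin, so on the support of `f` every smooth
function is of the form `‖y‖ ^ (1 - d) * ψ (y / ‖y‖ ^ 2)` with `ψ` smooth of compact support. -/
theorem exists_invPullback_eq (hρ : 0 < ρ) {R' : ℝ} (hR' : 0 < R') (χ : SmoothFunction d) :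
    ∃ (ψ : Euc d → ℂ) (hψ : ContDiff ℝ ∞ ψ), (∀ u, 2 * ρ⁻¹ ≤ ‖u‖ → ψ u = 0) ∧
      ∀ y, ρ < ‖y‖ → ‖y‖ < R' → invPullback ρ ψ hψ y = χ y := by
  have hρi : 0 < ρ⁻¹ := inv_pos.2 hρ
  have hσ : 0 < R'⁻¹ := inv_pos.2 hR'
  let β : ContDiffBump (0 : Euc d) := ⟨ρ⁻¹, 2 * ρ⁻¹, hρi, by linarith⟩
  have hβ : ContDiff ℝ ∞ (fun u : Euc d => (β u : ℂ)) :=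
    Complex.ofRealCLM.contDiff.comp β.contDiff
  refine ⟨fun u => (β u : ℂ) * invPullback R'⁻¹ χ χ.contDiff u,
    hβ.mul (SmoothFunction.contDiff _), fun u hu => ?_, fun y hy hy' => ?_⟩
  · have : β u = 0 := β.zero_of_le_dist (by simpa using hu)
    simp [this]
  · have hy0 : 0 < ‖y‖ := hρ.trans hy
    have hn := norm_regInv hρ hy.le
    have h1 : β (regInv ρ y) = 1 := by
      refine β.one_of_mem_closedBall ?_
      rw [mem_closedBall_zero_iff, hn]
      exact inv_anti₀ hρ hy.le
    have h2 : R'⁻¹ ≤ ‖regInv ρ y‖ := by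
      rw [hn]
      exact inv_anti₀ hy0 hy'.le
    have h3 : regSq R'⁻¹ (regInv ρ y) = (‖y‖ ^ 2)⁻¹ := by
      rw [regSq_eq hσ h2, hn, inv_pow]
    have h4 : regInv R'⁻¹ (regInv ρ y) = y := by
      rw [regInv, h3, inv_inv, regInv, regSq_eq hρ hy.le, smul_smul,
        mul_inv_cancel₀ (by positivity), one_smul]
    rw [invPullback_apply, h1, invPullback_apply, h3, h4, regSq_eq hρ hy.le,
      Real.inv_rpow (by positivity)]
    have h5 : (‖y‖ ^ 2) ^ (((1 : ℝ) - d) / 2) ≠ 0 := (Real.rpow_pos_of_pos (by positivity) _).ne'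
    have h6 : (((‖y‖ ^ 2) ^ (((1 : ℝ) - d) / 2) : ℝ) : ℂ) ≠ 0 := by exact_mod_cast h5
    rw [Complex.ofReal_inv]
    field_simp
    simp

end Inversion

end XRay

end

theorem mainTheorem7 (d : ℕ) (hd : 2 ≤ d) (ε R R' : ℝ) (hε : 0 < ε) (hεR : ε < R) (hRR' : R < R')
    (f : XRay.CompactDistribution d)
    (hsupp : f.support ⊆ Metric.closedBall 0 R' \ Metric.ball 0 R)
    (hX : XRay.VanishesOnLinesMeeting f (Metric.ball 0 ε)) :
    f = 0 := by
  -- `ρ` is small enough for `ρ + ε < R`, so that kernels smoothed inside the ball of radius `ρ` and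
  -- translated by less than `ε` are unmodified near the support of `f`
  obtain ⟨ρ, hρ, hρR⟩ : ∃ ρ : ℝ, 0 < ρ ∧ ρ + ε < R := ⟨(R - ε) / 2, by linarith, by linarith⟩
  have hR : ∀ x ∈ f.support, R ≤ ‖x‖ := fun x hx => by simpa using (hsupp hx).2
  have hR' : ∀ x ∈ f.support, ‖x‖ ≤ R' := fun x hx => by simpa using (hsupp hx).1
  have hρf : ∀ x ∈ f.support, ρ < ‖x‖ := fun x hx => by linarith [hR x hx]
  refine ContinuousLinearMap.ext fun χ => ?_
  obtain ⟨ψ, hψ, hψ0, hψχ⟩ :=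
    XRay.exists_invPullback_eq hρ (R' := R' + 1) (by linarith) χ
  have h : f (XRay.invPullback ρ ψ hψ) = 0 := by
    refine XRay.apply_invPullback_eq_zero (r := 2 * ρ⁻¹) hρ hρf
      (by linarith [inv_pos.2 hρ]) (XRay.apply_invPullback_polyEval fun n q hq => ?_) hψ hψ0
    exact XRay.apply_kernelFn_eq_zero hd hε hρ hR hρR hX hq
  rw [zero_apply, ← h]
  refine XRay.CompactDistribution.congr_of_eqOn (U := {x | ρ < ‖x‖ ∧ ‖x‖ < R' + 1})
    ((isOpen_lt continuous_const continuous_norm).inter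
      (isOpen_lt continuous_norm continuous_const))
    (fun x hx => ⟨hρf x hx, by linarith [hR' x hx]⟩) fun y hy => (hψχ y hy.1 hy.2).symm
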